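/- Let $\Lambda$ be the ring of symmetric functions over $\mathbb Q$ in variables $x_1,x_2,\dots$, with power sums $p_n$ ($n\ge1$), complete functions $h_n$ and elementary functions $e_n$ ($n\in\mathbb Z$; $h_0=e_0=1$ and $h_n=e_n=0$ for $n<0$). Since $\Lambda=\mathbb Q[p_1,p_2,\dots]$, the operators $\partial/\partial p_n$ act on $\Lambda$. Define operators $W_n,W^*_n$ ($n\in\mathbb Z$) on $\Lambda$ by $$W(z)=(1-z^2)\exp\Big(\sum_{n\ge1}\frac{p_n}{n}z^n\Big)\exp\Big(-\sum_{n\ge1}\frac{\partial}{\partial p_n}(z^{-n}+z^n)\Big)=\sum_{n\in\mathbb Z}W_nz^{-n},$$ $$W^*(z)=\exp\Big(-\sum_{n\ge1}\frac{p_n}{n}z^n\Big)\exp\Big(\sum_{n\ge1}\frac{\partial}{\partial p_n}(z^{-n}+z^n)\Big)=\sum_{n\in\mathbb Z}W^*_nz^{n}.$$ For a partition $\lambda$ of length $\ell$, with conjugate $\lambda'$, let $o_\lambda=\det(h_{\lambda_i-i+j}-h_{\lambda_i-i-j})_{1\le i,j\le \ell}$. Let $\lambda$ be any partition. Then: 1.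 For every $k\ge\ell$, writing $\lambda=(\lambda_1,\dots,\lambda_k)$ (trailing zeros allowed), $$W_{-\lambda_1}W_{-\lambda_2}\cdots W_{-\lambda_k}.1=o_\lambda=\det(h_{\lambda_i-i+j}-h_{\lambda_i-i-j})_{1\le i,j\le k}.$$ 2. For every $k\ge\max(\ell,1)$, $$W^*_{\lambda_1}W^*_{\lambda_2}\cdots W^*_{\lambda_k}.1=\frac{(-1)^{|\lambda|}}2\det(e_{\lambda_i-i+j}+e_{\lambda_i-i-j+2})_{1\le i,j\le k}.$$ 3. For every $l\ge\max(\lambda_1,1)$, $$o_\lambda=\frac12\det(e_{\lambda'_i-i+j}+e_{\lambda'_i-i-j+2})_{1\le i,j\le l}.$$ 4. If $\lambda=(\alpha|\beta)$ in Frobenius notation, i.e. $r$ is the number of boxes on the main diagonal of $\lambda$, $\alpha_i=\lambda_i-i$ and $\beta_i=\lambda'_i-i$ for $1\le i\le r$, and $|\beta|=\beta_1+\cdots+\beta_r$, then $$o_{(\alpha|\beta)}=(-1)^{|\beta|+r(r-1)/2}\,W_{-\alpha_1-1}\cdots W_{-\alpha_r-r}\,W^*_{\beta_1-(r-1)}W^*_{\beta_2-(r-2)}\cdots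 W^*_{\beta_r}.1,$$ $$o_{(\alpha|\beta)}=(-1)^{|\beta|+r(r+1)/2}\,W^*_{\beta_1+1}\cdots W^*_{\beta_r+r}\,W_{-\alpha_1+(r-1)}W_{-\alpha_2+(r-2)}\cdots W_{-\alpha_r}.1.$$ -/

import Mathlib

noncomputable section

namespace SymFun

/-- The ring `Λ` of symmetric functions in the variables `x₀, x₁, x₂, …` over `ℚ`: the formal power
series of bounded degree that are invariant under all permutations of the variables. -/
def SymmFn : Subalgebra ℚ (MvPowerSeries ℕ ℚ) where
  carrier := {f | (∀ σ : Equiv.Perm ℕ, MvPowerSeries.rename σ f = f) ∧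
    ∃ d : ℕ, ∀ m : ℕ →₀ ℕ, d < m.degree → MvPowerSeries.coeff m f = 0}
  mul_mem' := by
    classical
    rintro f g ⟨hf, a, ha⟩ ⟨hg, b, hb⟩
    refine ⟨fun σ => by rw [map_mul, hf, hg], a + b, fun m hm => ?_⟩
    rw [MvPowerSeries.coeff_mul]
    refine Finset.sum_eq_zero fun x hx => ?_
    rw [Finset.HasAntidiagonal.mem_antidiagonal] at hx
    have h : x.1.degree + x.2.degree = m.degree := by rw [← hx, map_add]
    by_cases h1 : a < x.1.degree
    · rw [ha _ h1, zero_mul]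
    · rw [hb _ (by omega), mul_zero]
  add_mem' := by
    rintro f g ⟨hf, a, ha⟩ ⟨hg, b, hb⟩
    refine ⟨fun σ => by rw [map_add, hf, hg], max a b, fun m hm => ?_⟩
    rw [map_add, ha _ (lt_of_le_of_lt (le_max_left _ _) hm),
      hb _ (lt_of_le_of_lt (le_max_right _ _) hm), add_zero]
  algebraMap_mem' := by
    classical
    intro r
    refine ⟨fun σ => AlgHom.commutes _ _, 0, fun m hm => ?_⟩
    rw [MvPowerSeries.algebraMap_apply, MvPowerSeries.coeff_C, if_neg]
    rintro rfl
    simp at hm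

theorem rename_eq_self {f : MvPowerSeries ℕ ℚ} (hf : ∀ (σ : Equiv.Perm ℕ) (m : ℕ →₀ ℕ),
      MvPowerSeries.coeff (m.embDomain σ.toEmbedding) f = MvPowerSeries.coeff m f)
    (σ : Equiv.Perm ℕ) : MvPowerSeries.rename σ f = f := by
  ext m
  obtain ⟨k, rfl⟩ : ∃ k : ℕ →₀ ℕ, k.embDomain σ.toEmbedding = m :=
    ⟨m.embDomain σ.symm.toEmbedding, by
      ext i
      obtain ⟨j, rfl⟩ := σ.surjective i
      have := Finsupp.embDomain_apply_self σ.toEmbedding (m.embDomain σ.symm.toEmbedding) j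
      have h2 := Finsupp.embDomain_apply_self σ.symm.toEmbedding m (σ j)
      simp at this h2
      rw [this, h2]⟩
  rw [hf]
  exact MvPowerSeries.coeff_embDomain_rename σ.toEmbedding f k

theorem coeff_perm (f : SymmFn) (σ : Equiv.Perm ℕ) (m : ℕ →₀ ℕ) :
    MvPowerSeries.coeff (m.embDomain σ.toEmbedding) (f : MvPowerSeries ℕ ℚ) =
      MvPowerSeries.coeff m (f : MvPowerSeries ℕ ℚ) := by
  conv_lhs => rw [← f.2.1 σ]
  exact MvPowerSeries.coeff_embDomain_rename σ.toEmbedding _ m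

theorem degree_embDomain {ι : Type*} (e : ι ↪ ℕ) (m : ι →₀ ℕ) :
    (m.embDomain e).degree = m.degree := by
  simp [Finsupp.degree_apply, Finsupp.support_embDomain, Finsupp.embDomain_apply_self]

/-- The complete homogeneous symmetric function `h_n`: the sum of all monomials of degree `n`.
In particular `h_0 = 1`, and `h_n = 0` for `n < 0`. -/
def h (n : ℤ) : SymmFn :=
  ⟨fun m => if (m.degree : ℤ) = n then 1 else 0, by
    refine ⟨rename_eq_self fun σ m => ?_, n.toNat, fun m hm => ?_⟩
    · change ite _ _ _ = ite _ _ _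
      rw [degree_embDomain]
    · change ite _ _ _ = _
      rw [if_neg]
      omega⟩

/-- The elementary symmetric function `e_n`: the sum of all squarefree monomials of degree `n`.
In particular `e_0 = 1`, and `e_n = 0` for `n < 0`. -/
def e (n : ℤ) : SymmFn := by
  classical
  exact ⟨fun m => if (m.degree : ℤ) = n ∧ ∀ i, m i ≤ 1 then 1 else 0, by
    refine ⟨rename_eq_self fun σ m => ?_, n.toNat, fun m hm => ?_⟩
    · change ite _ _ _ = ite _ _ _
      rw [degree_embDomain]
      refine if_congr (and_congr Iff.rfl ⟨fun H i => ?_, fun H i => ?_⟩) rfl rfl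
      · have := H (σ i)
        rwa [show σ i = σ.toEmbedding i from rfl, Finsupp.embDomain_apply_self] at this
      · obtain ⟨j, rfl⟩ := σ.surjective i
        rw [show σ j = σ.toEmbedding j from rfl, Finsupp.embDomain_apply_self]
        exact H j
    · change ite _ _ _ = _
      rw [if_neg]
      omega⟩

/-- The power sum `p_n = ∑ᵢ xᵢⁿ`, for `n ≥ 1`. -/
def p (n : ℕ+) : SymmFn := by
  classical
  exact ⟨fun m => if ∃ i, m = Finsupp.single i (n : ℕ) then 1 else 0, by
    refine ⟨rename_eq_self fun σ m => ?_, n, fun m hm => ?_⟩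
    · change ite _ _ _ = ite _ _ _
      refine if_congr ⟨?_, ?_⟩ rfl rfl
      · rintro ⟨i, hi⟩
        refine ⟨σ.symm i, Finsupp.embDomain_injective σ.toEmbedding ?_⟩
        rw [hi, Finsupp.embDomain_single]; simp
      · rintro ⟨i, rfl⟩
        exact ⟨σ i, by rw [Finsupp.embDomain_single]; simp⟩
    · change ite _ _ _ = _
      rw [if_neg]
      rintro ⟨i, rfl⟩
      simp at hm⟩

open Classical in
theorem coeff_p (n : ℕ+) (m : ℕ →₀ ℕ) : MvPowerSeries.coeff m (p n : MvPowerSeries ℕ ℚ) =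
    if ∃ i, m = Finsupp.single i (n : ℕ) then 1 else 0 := by
  rfl

theorem degree_of_coeff_p {n : ℕ+} {m : ℕ →₀ ℕ}
    (h : MvPowerSeries.coeff m (p n : MvPowerSeries ℕ ℚ) ≠ 0) : m.degree = n := by
  classical
  rw [coeff_p, ne_eq, ite_eq_right_iff, not_forall] at h
  obtain ⟨⟨i, rfl⟩, -⟩ := h
  simp

/-- The homomorphism from the polynomial ring `ℚ[X₁, X₂, …]` to `Λ` with `X_n ↦ p_n`; it is shown
below to be bijective, so that `∂/∂p_n` makes sense on `Λ`. -/
def P : MvPolynomial ℕ+ ℚ →ₐ[ℚ] SymmFn := MvPolynomial.aeval p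

/-- The coefficient of the monomial `x^m`. -/
abbrev cf (m : ℕ →₀ ℕ) (f : SymmFn) : ℚ := MvPowerSeries.coeff m (f : MvPowerSeries ℕ ℚ)

theorem exists_component (Q : MvPolynomial ℕ+ ℚ) : ∀ d : ℕ, ∃ Q' : MvPolynomial ℕ+ ℚ,
    ∀ m, cf m (P Q') = if m.degree = d then cf m (P Q) else 0 := by
  classical
  induction Q using MvPolynomial.induction_on with
  | C a =>
    intro d
    by_cases hd : d = 0
    · subst hd
      refine ⟨MvPolynomial.C a, fun m => ?_⟩
      split_ifs with h
      · rfl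
      · have : P (MvPolynomial.C a) = algebraMap ℚ SymmFn a := MvPolynomial.algHom_C _ _
        rw [this, cf, Subalgebra.coe_algebraMap, MvPowerSeries.algebraMap_apply,
          MvPowerSeries.coeff_C, if_neg]
        rintro rfl; simp at h
    · refine ⟨0, fun m => ?_⟩
      rw [map_zero, cf, ZeroMemClass.coe_zero, map_zero]
      split_ifs with h
      · have : P (MvPolynomial.C a) = algebraMap ℚ SymmFn a := MvPolynomial.algHom_C _ _
        rw [this, cf, Subalgebra.coe_algebraMap, MvPowerSeries.algebraMap_apply,
          MvPowerSeries.coeff_C, if_neg]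
        rintro rfl; simp at h; omega
      · rfl
  | add Q R hQ hR =>
    intro d
    obtain ⟨Q', hQ'⟩ := hQ d
    obtain ⟨R', hR'⟩ := hR d
    refine ⟨Q' + R', fun m => ?_⟩
    have hq := hQ' m
    have hr := hR' m
    simp only [cf] at hq hr
    simp only [cf, map_add, AddMemClass.coe_add, hq, hr]
    split_ifs <;> simp
  | mul_X Q n hQ =>
    intro d
    have key : ∀ (R : MvPolynomial ℕ+ ℚ) m, cf m (P (R * MvPolynomial.X n)) =
        ∑ x ∈ Finset.HasAntidiagonal.antidiagonal m, cf x.1 (P R) * cf x.2 (p n) := by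
      intro R m
      have : P (MvPolynomial.X n) = p n := MvPolynomial.aeval_X _ _
      rw [cf, map_mul, this, MulMemClass.coe_mul, MvPowerSeries.coeff_mul]
    by_cases hn : (n : ℕ) ≤ d
    · obtain ⟨Q', hQ'⟩ := hQ (d - n)
      refine ⟨Q' * MvPolynomial.X n, fun m => ?_⟩
      rw [key, key]
      split_ifs with h
      · refine Finset.sum_congr rfl fun x hx => ?_
        rw [Finset.HasAntidiagonal.mem_antidiagonal] at hx
        by_cases hp : cf x.2 (p n) = 0
        · rw [hp, mul_zero, mul_zero]
        · have := degree_of_coeff_p hp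
          have h3 : x.1.degree + x.2.degree = m.degree := by rw [← hx, map_add]
          rw [hQ', if_pos (by omega)]
      · refine Finset.sum_eq_zero fun x hx => ?_
        rw [Finset.HasAntidiagonal.mem_antidiagonal] at hx
        by_cases hp : cf x.2 (p n) = 0
        · rw [hp, mul_zero]
        · have := degree_of_coeff_p hp
          have h3 : x.1.degree + x.2.degree = m.degree := by rw [← hx, map_add]
          rw [hQ', if_neg (by omega), zero_mul]
    · refine ⟨0, fun m => ?_⟩
      rw [map_zero, cf, ZeroMemClass.coe_zero, map_zero]
      split_ifs with h
      · rw [key]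
        symm
        refine Finset.sum_eq_zero fun x hx => ?_
        rw [Finset.HasAntidiagonal.mem_antidiagonal] at hx
        by_cases hp : cf x.2 (p n) = 0
        · rw [hp, mul_zero]
        · have := degree_of_coeff_p hp
          have h3 : x.1.degree + x.2.degree = m.degree := by rw [← hx, map_add]
          omega
      · rfl

/-- Setting `x_i = 0` for `i ≥ N`. -/
def res (N : ℕ) : SymmFn →ₐ[ℚ] MvPowerSeries (Fin N) ℚ :=
  (MvPowerSeries.killCompl (Fin.valEmbedding (n := N))).comp SymmFn.val

theorem coeff_res (N : ℕ) (f : SymmFn) (m : Fin N →₀ ℕ) :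
    MvPowerSeries.coeff m (res N f) = cf (m.embDomain Fin.valEmbedding) f :=
  MvPowerSeries.coeff_killCompl _ _

theorem res_p (N : ℕ) (n : ℕ+) : res N (p n) =
    ((MvPolynomial.psum (Fin N) ℚ n : MvPolynomial (Fin N) ℚ) : MvPowerSeries (Fin N) ℚ) := by
  classical
  ext m
  rw [coeff_res, cf, coeff_p, MvPolynomial.coeff_coe, MvPolynomial.psum, MvPolynomial.coeff_sum]
  simp_rw [MvPolynomial.coeff_X_pow]
  split_ifs with h
  · obtain ⟨i, hi⟩ := h
    have hmem : i ∈ (m.embDomain (Fin.valEmbedding (n := N))).support := by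
      rw [hi]; simp
    rw [Finsupp.support_embDomain, Finset.mem_map] at hmem
    obtain ⟨j, -, rfl⟩ := hmem
    rw [← Finsupp.embDomain_single] at hi
    have := Finsupp.embDomain_injective _ hi
    subst this
    rw [Finset.sum_eq_single j]
    · simp
    · intro b _ hb
      rw [if_neg]
      intro h
      exact hb (Finsupp.single_left_injective n.pos.ne' h)
    · simp
  · symm
    refine Finset.sum_eq_zero fun i _ => if_neg ?_
    rintro rfl
    exact h ⟨i, by rw [Finsupp.embDomain_single]; rfl⟩

theorem res_P (N : ℕ) (Q : MvPolynomial ℕ+ ℚ) : res N (P Q) =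
    ((MvPolynomial.aeval (fun n : ℕ+ => MvPolynomial.psum (Fin N) ℚ n) Q :
      MvPolynomial (Fin N) ℚ) : MvPowerSeries (Fin N) ℚ) := by
  have : (res N).comp P = (MvPolynomial.coeToMvPowerSeries.algHom ℚ).comp
      (MvPolynomial.aeval (fun n : ℕ+ => MvPolynomial.psum (Fin N) ℚ n)) := by
    ext1 n
    simp [P, res_p]
  simpa using DFunLike.congr_fun this Q

/-- The power sums `p_1, …, p_N` in `N` variables. -/
def ps (N : ℕ) : MvPolynomial (Fin N) ℚ →ₐ[ℚ] MvPolynomial.symmetricSubalgebra (Fin N) ℚ :=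
  MvPolynomial.aeval fun i => ⟨MvPolynomial.psum (Fin N) ℚ (i + 1),
    MvPolynomial.psum_isSymmetric _ _ _⟩

theorem ps_surjective (N : ℕ) : Function.Surjective (ps N) := by
  have hes : ∀ k : ℕ, k ≤ N →
      (⟨MvPolynomial.esymm (Fin N) ℚ k, MvPolynomial.esymm_isSymmetric _ _ _⟩ :
        MvPolynomial.symmetricSubalgebra (Fin N) ℚ) ∈ (ps N).range := by
    intro k
    induction k using Nat.strong_induction_on with
    | _ k ih =>
      intro hk
      rcases Nat.eq_zero_or_pos k with rfl | hk0
      · convert (ps N).range.one_mem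
        ext1
        simp
      · have hN := MvPolynomial.mul_esymm_eq_sum (Fin N) ℚ k
        have hmem : ∀ a ∈ (Finset.HasAntidiagonal.antidiagonal k).filter (fun a : ℕ × ℕ => a.1 < k),
            ((-1) ^ a.1 * (⟨MvPolynomial.esymm (Fin N) ℚ a.1,
              MvPolynomial.esymm_isSymmetric _ _ _⟩ :
                MvPolynomial.symmetricSubalgebra (Fin N) ℚ) *
            ⟨MvPolynomial.psum (Fin N) ℚ a.2, MvPolynomial.psum_isSymmetric _ _ _⟩) ∈
              (ps N).range := by
          intro a ha
          rw [Finset.mem_filter, Finset.HasAntidiagonal.mem_antidiagonal] at ha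
          refine mul_mem (mul_mem (pow_mem (neg_mem (one_mem _)) _) (ih _ ha.2 (by omega))) ?_
          refine ⟨MvPolynomial.X ⟨a.2 - 1, by omega⟩, ?_⟩
          change ps N (MvPolynomial.X _) = _
          rw [ps, MvPolynomial.aeval_X]
          refine Subtype.ext (congrArg (MvPolynomial.psum (Fin N) ℚ) ?_)
          have := ha.1
          simp only
          omega
        have hs := (ps N).range.smul_mem (mul_mem (pow_mem (neg_mem (one_mem _)) (k + 1))
          (sum_mem hmem)) ((k : ℚ)⁻¹)
        convert hs
        ext1
        simp only [SetLike.val_smul, MulMemClass.coe_mul, AddSubmonoidClass.coe_finsetSum,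
          SubmonoidClass.coe_pow, NegMemClass.coe_neg, OneMemClass.coe_one]
        rw [← hN, ← nsmul_eq_mul, ← Nat.cast_smul_eq_nsmul ℚ, smul_smul,
          inv_mul_cancel₀ (by positivity), one_smul]
  intro f
  obtain ⟨g, rfl⟩ := MvPolynomial.esymmAlgHom_surjective (σ := Fin N) ℚ (n := N) (by simp) f
  change _ ∈ (ps N).range
  induction g using MvPolynomial.induction_on with
  | C a =>
    rw [MvPolynomial.algHom_C]; exact Subalgebra.algebraMap_mem _ _
  | add a b ha hb => rw [map_add]; exact add_mem ha hb
  | mul_X a i ha =>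
    rw [map_mul]
    refine mul_mem ha ?_
    have := hes (i + 1) i.2
    simpa [MvPolynomial.esymmAlgHom] using this

theorem ps_injective (N : ℕ) : Function.Injective (ps N) := by
  let φ : MvPolynomial (Fin N) ℚ →ₐ[ℚ] MvPolynomial (Fin N) ℚ :=
    ((MvPolynomial.esymmAlgEquiv (Fin N) ℚ (n := N) (by simp)).symm : _ →ₐ[ℚ] _).comp (ps N)
  have hφ : Function.Surjective φ :=
    (MvPolynomial.esymmAlgEquiv (Fin N) ℚ (n := N) (by simp)).symm.surjective.comp
      (ps_surjective N)
  have : Function.Injective φ := by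
    rw [injective_iff_map_eq_zero]
    intro a ha
    have hmono : Monotone fun n : ℕ => RingHom.ker (φ ^ n) := by
      refine monotone_nat_of_le_succ fun n x hx => ?_
      rw [RingHom.mem_ker] at hx ⊢
      rw [pow_succ', AlgHom.mul_apply, hx, map_zero]
    obtain ⟨n, hn⟩ := monotone_stabilizes_iff_noetherian.mpr
      (inferInstanceAs (IsNoetherianRing (MvPolynomial (Fin N) ℚ))) ⟨_, hmono⟩
    have hsurj : Function.Surjective (φ ^ n) := by
      rw [AlgHom.coe_pow]; exact hφ.iterate n
    obtain ⟨b, rfl⟩ := hsurj a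
    have hb : b ∈ RingHom.ker (φ ^ (n + 1)) := by
      rw [RingHom.mem_ker, pow_succ', AlgHom.mul_apply, ha]
    have := hn (n + 1) (by omega)
    simp only [OrderHom.coe_mk] at this
    rw [← this, RingHom.mem_ker] at hb
    exact hb
  intro a b hab
  apply this
  simp [φ, hab]

/-- `0, …, N - 1` as the positive integers `1, …, N`. -/
def idx (N : ℕ) (i : Fin N) : ℕ+ := ⟨i + 1, by omega⟩

theorem aeval_psum_rename (N : ℕ) (Q : MvPolynomial (Fin N) ℚ) :
    MvPolynomial.aeval (fun n : ℕ+ => MvPolynomial.psum (Fin N) ℚ n)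
      (MvPolynomial.rename (idx N) Q) = (ps N Q : MvPolynomial (Fin N) ℚ) := by
  rw [MvPolynomial.aeval_rename]
  have : (MvPolynomial.aeval ((fun n : ℕ+ => MvPolynomial.psum (Fin N) ℚ n) ∘
      (idx N))) =
      (MvPolynomial.symmetricSubalgebra (Fin N) ℚ).val.comp (ps N) := by
    ext1 i
    simp [ps, idx]
  rw [this]
  rfl

theorem P_injective : Function.Injective P := by
  rw [injective_iff_map_eq_zero]
  intro Q hQ
  obtain ⟨N, hN⟩ : ∃ N : ℕ, ∀ n ∈ Q.vars, (n : ℕ) ≤ N :=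
    ⟨Q.vars.sup fun n => (n : ℕ), fun n hn => Finset.le_sup (f := fun n : ℕ+ => (n : ℕ)) hn⟩
  obtain ⟨R, rfl⟩ := MvPolynomial.exists_rename_eq_of_vars_subset_range Q
    (idx N) (fun i j hij => by
      have := congrArg PNat.val hij
      simp only [idx, PNat.mk_coe] at this
      ext; omega)
    (fun n hn => ⟨⟨(n : ℕ) - 1, by have := hN n hn; have := n.pos; omega⟩, by
      refine PNat.eq ?_
      have := n.pos
      simp only [idx, PNat.mk_coe]; omega⟩)
  have h := res_P N (MvPolynomial.rename (idx N) R)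
  rw [hQ, map_zero, aeval_psum_rename] at h
  have h0 : ps N R = 0 := by
    refine Subtype.ext (MvPolynomial.coe_injective (σ := Fin N) (R := ℚ) ?_)
    rw [← h]
    simp
  rw [ps_injective N (h0.trans (map_zero _).symm), map_zero]

/-- Every exponent of degree at most `N` can be moved into the first `N` variables. -/
theorem exists_perm (N : ℕ) (m : ℕ →₀ ℕ) (hm : m.degree ≤ N) : ∃ (σ : Equiv.Perm ℕ)
    (k : Fin N →₀ ℕ), m.embDomain σ.toEmbedding = k.embDomain Fin.valEmbedding := by
  have hc : m.support.card ≤ N := by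
    refine le_trans ?_ hm
    rw [Finsupp.degree_apply, Finset.card_eq_sum_ones]
    exact Finset.sum_le_sum fun i hi => Nat.one_le_iff_ne_zero.mpr (Finsupp.mem_support_iff.mp hi)
  let e : {i // i ∈ m.support} ≃ {i // i ∈ Finset.range m.support.card} :=
    Finset.equivOfCardEq (by simp)
  refine ⟨e.extendSubtype, ?_⟩
  have hr : ((m.embDomain e.extendSubtype.toEmbedding).support : Set ℕ) ⊆
      Set.range (Fin.valEmbedding (n := N)) := by
    intro i hi
    rw [Finsupp.support_embDomain, Finset.mem_coe, Finset.mem_map] at hi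
    obtain ⟨j, hj, rfl⟩ := hi
    have := e.extendSubtype_mem j hj
    rw [Finset.mem_range] at this
    exact ⟨⟨_, lt_of_lt_of_le this hc⟩, rfl⟩
  obtain ⟨k, hk⟩ := (Finsupp.mem_range_embDomain_iff Fin.valEmbedding _).mpr hr
  exact ⟨k, hk.symm⟩

theorem P_surjective : Function.Surjective P := by
  classical
  intro f
  obtain ⟨d, hd⟩ := f.2.2
  -- each homogeneous component is attained
  have hcomp : ∀ k : ℕ, ∃ Q, ∀ m, cf m (P Q) = if m.degree = k then cf m f else 0 := by
    intro k
    let g : MvPolynomial (Fin k) ℚ := MvPowerSeries.truncTotal (d + 1) (res k f)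
    have hg : (g : MvPowerSeries (Fin k) ℚ) = res k f := by
      ext m
      rw [MvPolynomial.coeff_coe, MvPowerSeries.coeff_truncTotal_eq_ite]
      split_ifs with h
      · rfl
      · rw [coeff_res, cf, hd]
        rw [degree_embDomain]; omega
    have hsymm : g.IsSymmetric := by
      intro σ
      apply MvPolynomial.coe_injective
      rw [← MvPowerSeries.rename_coe, hg]
      ext x
      obtain ⟨y, rfl⟩ : ∃ y : Fin k →₀ ℕ, y.embDomain σ.toEmbedding = x :=
        (Finsupp.mem_range_embDomain_iff _ _).mpr (by simp)
      have h1 := MvPowerSeries.coeff_embDomain_rename σ.toEmbedding (res k f) y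
      refine Eq.trans h1 ?_
      rw [coeff_res, coeff_res, cf, cf, ← coeff_perm f (σ.viaEmbedding Fin.valEmbedding)]
      congr 2
      simp only [Finsupp.embDomain_eq_mapDomain, ← Finsupp.mapDomain_comp]
      congr 1
      funext i
      simp
      exact Equiv.Perm.viaEmbedding_apply σ Fin.valEmbedding i
    obtain ⟨R, hR⟩ := ps_surjective k ⟨g, hsymm⟩
    obtain ⟨Q, hQ⟩ := exists_component
      (MvPolynomial.rename (idx k) R) k
    refine ⟨Q, fun m => ?_⟩
    rw [hQ]
    refine if_ctx_congr Iff.rfl (fun hm => ?_) (fun _ => rfl)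
    obtain ⟨σ, l, hl⟩ := exists_perm k m hm.le
    rw [cf, ← coeff_perm _ σ, hl, cf, ← coeff_perm f σ, hl]
    have h1 := coeff_res k (P (MvPolynomial.rename (idx k) R)) l
    have h2 := coeff_res k f l
    rw [res_P, aeval_psum_rename, hR] at h1
    rw [← hg] at h2
    exact h1.symm.trans h2
  choose Q hQ using hcomp
  refine ⟨∑ k ∈ Finset.range (d + 1), Q k, ?_⟩
  ext m
  change cf m _ = cf m f
  have : cf m (P (∑ k ∈ Finset.range (d + 1), Q k)) =
      ∑ k ∈ Finset.range (d + 1), cf m (P (Q k)) := by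
    simp [cf]
  rw [this]
  simp_rw [hQ]
  rw [Finset.sum_ite_eq]
  split_ifs with h
  · rfl
  · rw [Finset.mem_range] at h
    exact (hd m (by omega)).symm

/-- The ring of symmetric functions is the polynomial ring in the power sums. -/
def powerSumEquiv : MvPolynomial ℕ+ ℚ ≃ₐ[ℚ] SymmFn :=
  AlgEquiv.ofBijective P ⟨P_injective, P_surjective⟩



/-- The operator `∂/∂p_n` on `Λ = ℚ[p₁, p₂, …]`. -/
def dp (n : ℕ+) : SymmFn →ₗ[ℚ] SymmFn :=
  powerSumEquiv.toLinearMap ∘ₗ (MvPolynomial.pderiv n).toLinearMap ∘ₗ powerSumEquiv.symm.toLinearMap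

open scoped LaurentPolynomial

/-- `∂/∂p_n` acting coefficientwise on `Λ[z, z⁻¹]` (the variable `z` is called `T`). -/
def dpL (n : ℕ+) : SymmFn[T;T⁻¹] →ₗ[ℚ] SymmFn[T;T⁻¹] where
  toFun g := .ofCoeff (g.coeff.mapRange (dp n) (map_zero _))
  map_add' f g := by ext1 j; simp
  map_smul' r f := by ext1 j; simp

theorem coeff_dpL (n : ℕ+) (g : SymmFn[T;T⁻¹]) (j : ℤ) :
    (dpL n g).coeff j = dp n (g.coeff j) := rfl

theorem finite_dpL (g : SymmFn[T;T⁻¹]) : {n | dpL n g ≠ 0}.Finite := by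
  refine (Finset.finite_toSet (g.coeff.support.biUnion fun j =>
    (powerSumEquiv.symm (g.coeff j)).vars)).subset fun n hn => ?_
  by_contra h
  apply hn
  ext1 j
  rw [coeff_dpL]
  by_cases hj : g.coeff j = 0
  · rw [hj, map_zero]; rfl
  · have : n ∉ (powerSumEquiv.symm (g.coeff j)).vars := by
      intro hv
      exact h (Finset.mem_coe.mpr (Finset.mem_biUnion.mpr ⟨j, Finsupp.mem_support_iff.mpr hj, hv⟩))
    change powerSumEquiv (MvPolynomial.pderiv n (powerSumEquiv.symm (g.coeff j))) = 0
    rw [MvPolynomial.pderiv_eq_zero_of_notMem_vars this, map_zero]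

theorem finite_terms (g : SymmFn[T;T⁻¹]) : (Function.support fun n : ℕ+ =>
    (LaurentPolynomial.T (n : ℤ) + LaurentPolynomial.T (-(n : ℤ))) * dpL n g).Finite :=
  (finite_dpL g).subset fun n hn h => hn (by simp only [h, mul_zero])

/-- The operator `∑_{n ≥ 1} (zⁿ + z⁻ⁿ) ∂/∂p_n` on `Λ[z, z⁻¹]`; on each element only finitely many
terms of the sum are nonzero. -/
def shiftD : SymmFn[T;T⁻¹] →ₗ[ℚ] SymmFn[T;T⁻¹] where
  toFun g := ∑ᶠ n : ℕ+,
    (LaurentPolynomial.T (n : ℤ) + LaurentPolynomial.T (-(n : ℤ))) * dpL n g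
  map_add' f g := by
    rw [← finsum_add_distrib (finite_terms f) (finite_terms g)]
    exact finsum_congr fun n => by rw [map_add, mul_add]
  map_smul' r f := by
    rw [RingHom.id_apply, smul_finsum' r (finite_terms f)]
    exact finsum_congr fun n => by rw [map_smul, mul_smul_comm]

/-- Laurent polynomials whose coefficients have degree `< d` as polynomials in the `p_n`. -/
def lowDeg (d : ℕ) : Submodule ℚ SymmFn[T;T⁻¹] where
  carrier := {g | ∀ j m, (powerSumEquiv.symm (g.coeff j)).coeff m ≠ 0 → m.degree < d}
  zero_mem' j m h := by simp at h
  add_mem' {f g} hf hg j m h := by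
    by_contra hd
    refine h ?_
    have h1 : (powerSumEquiv.symm (f.coeff j)).coeff m = 0 := by
      by_contra h1; exact hd (hf j m h1)
    have h2 : (powerSumEquiv.symm (g.coeff j)).coeff m = 0 := by
      by_contra h1; exact hd (hg j m h1)
    simp [h1, h2]
  smul_mem' r f hf j m h := by
    refine hf j m fun h0 => h ?_
    simp [h0]

theorem T_mul_mem {d : ℕ} (n : ℤ) {g : SymmFn[T;T⁻¹]} (hg : g ∈ lowDeg d) :
    LaurentPolynomial.T n * g ∈ lowDeg d := by
  intro j m h
  refine hg (j - n) m ?_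
  have : (LaurentPolynomial.T n * g).coeff j = g.coeff (j - n) := by
    rw [LaurentPolynomial.T_mul, LaurentPolynomial.T]
    rw [AddMonoidAlgebra.coeff_mul_single_eq_coeff_mul (m₂ := j - n), mul_one]
    intro a _
    constructor <;> intro h <;> omega
  rwa [this] at h

theorem shiftD_mem {d : ℕ} {g : SymmFn[T;T⁻¹]} (hg : g ∈ lowDeg (d + 1)) :
    shiftD g ∈ lowDeg d := by
  change (∑ᶠ n : ℕ+, _) ∈ _
  rw [finsum_eq_sum _ (finite_terms g)]
  refine Submodule.sum_mem _ fun n _ => ?_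
  have h : dpL n g ∈ lowDeg d := by
    intro j m h
    have e : powerSumEquiv.symm ((dpL n g).coeff j) =
        MvPolynomial.pderiv n (powerSumEquiv.symm (g.coeff j)) := by
      rw [coeff_dpL]
      exact powerSumEquiv.symm_apply_apply _
    rw [e, MvPolynomial.coeff_pderiv] at h
    have := hg j _ (left_ne_zero_of_mul h)
    rw [map_add, Finsupp.degree_single] at this
    omega
  rw [add_mul]
  exact Submodule.add_mem _ (T_mul_mem _ h) (T_mul_mem _ h)

theorem finite_pow (f : SymmFn) (c : ℕ → ℚ) : (Function.support fun k : ℕ =>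
    c k • (shiftD ^ k) (LaurentPolynomial.C f)).Finite := by
  let q := powerSumEquiv.symm f
  have h0 : LaurentPolynomial.C f ∈ lowDeg (q.totalDegree + 1) := by
    intro j m h
    rw [LaurentPolynomial.C_apply] at h
    split_ifs at h
    · have := MvPolynomial.le_totalDegree (MvPolynomial.mem_support_iff.mpr h)
      rw [Finsupp.degree_apply]
      exact Nat.lt_succ_of_le this
    · simp at h
  have hk : ∀ d k g, g ∈ lowDeg d → d ≤ k → (shiftD ^ k) g = 0 := by
    intro d
    induction d with
    | zero =>
      intro k g hg _
      have : g = 0 := by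
        ext1 j
        apply powerSumEquiv.symm.injective
        ext m
        by_contra h
        exact absurd (hg j m (by simpa using h)) (Nat.not_lt_zero _)
      rw [this, map_zero]
    | succ d ih =>
      intro k g hg hdk
      obtain ⟨k, rfl⟩ : ∃ l, k = l + 1 := ⟨k - 1, by omega⟩
      rw [pow_succ, Module.End.mul_apply]
      exact ih k _ (shiftD_mem hg) (by omega)
  refine (Set.finite_lt_nat (q.totalDegree + 1)).subset fun k h => ?_
  by_contra hlt
  exact h (by simp only [hk _ k _ h0 (not_lt.mp hlt), smul_zero])

/-- The operator `exp (s · ∑_{n ≥ 1} (zⁿ + z⁻ⁿ) ∂/∂p_n) : Λ → Λ[z, z⁻¹]`; on each element only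
finitely many terms of the exponential series are nonzero. -/
def expShift (s : ℚ) : SymmFn →ₗ[ℚ] SymmFn[T;T⁻¹] where
  toFun f := ∑ᶠ k : ℕ, (s ^ k / (k.factorial : ℚ)) • (shiftD ^ k) (LaurentPolynomial.C f)
  map_add' f g := by
    rw [← finsum_add_distrib (finite_pow f _) (finite_pow g _)]
    exact finsum_congr fun n => by rw [map_add, map_add, smul_add]
  map_smul' r f := by
    rw [RingHom.id_apply, smul_finsum' r (finite_pow f _)]
    refine finsum_congr fun n => ?_
    have : (LaurentPolynomial.C (r • f) : SymmFn[T;T⁻¹]) = r • LaurentPolynomial.C f := by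
      ext1 j; simp [LaurentPolynomial.C_apply]
    rw [this, map_smul, smul_comm]

/-- The formal power series `exp (s · ∑_{n ≥ 1} p_n zⁿ / n)` with coefficients in `Λ`. -/
def expMul (s : ℚ) : PowerSeries SymmFn :=
  (PowerSeries.exp ℚ).subst
    (PowerSeries.mk fun n => if h : 0 < n then (s / (n : ℚ)) • p ⟨n, h⟩ else 0 : PowerSeries SymmFn)

theorem laurent_smul (r : ℚ) (x : LaurentSeries SymmFn) :
    r • x = HahnSeries.C (algebraMap ℚ SymmFn r) * x := by
  ext1
  funext j
  rw [HahnSeries.C_apply, HahnSeries.single_zero_mul_eq_smul, HahnSeries.coeff_smul,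
    HahnSeries.coeff_smul, algebraMap_smul]

/-- `exp (s ∑_{n ≥ 1} p_n zⁿ / n) exp (-s ∑_{n ≥ 1} (zⁿ + z⁻ⁿ) ∂/∂p_n) : Λ → Λ((z))`. -/
def vertex (s : ℚ) : SymmFn →ₗ[ℚ] LaurentSeries SymmFn where
  toFun f := HahnSeries.ofPowerSeries ℤ SymmFn (expMul s) *
    HahnSeries.ofFinsupp (expShift (-s) f).coeff
  map_add' f g := by
    rw [← mul_add]
    congr 1
    ext1; funext j
    simp
  map_smul' r f := by
    rw [RingHom.id_apply, laurent_smul, mul_left_comm, ← laurent_smul]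
    congr 1
    ext1; funext j
    simp

/-- The vertex operator `W(z) = (1 - z²) exp (∑ p_n zⁿ / n) exp (-∑ (zⁿ + z⁻ⁿ) ∂/∂p_n)`. -/
def Wz : SymmFn →ₗ[ℚ] LaurentSeries SymmFn where
  toFun f := (1 - HahnSeries.single 2 1) * vertex 1 f
  map_add' f g := by rw [map_add, mul_add]
  map_smul' r f := by
    rw [map_smul, RingHom.id_apply, laurent_smul, mul_left_comm, ← laurent_smul]

/-- The vertex operator `W*(z) = exp (-∑ p_n zⁿ / n) exp (∑ (zⁿ + z⁻ⁿ) ∂/∂p_n)`. -/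
def WzStar : SymmFn →ₗ[ℚ] LaurentSeries SymmFn := vertex (-1)

/-- The mode `W_n`, defined by `W(z) = ∑ₙ W_n z⁻ⁿ`. -/
def W (n : ℤ) : Module.End ℚ SymmFn where
  toFun f := (Wz f).coeff (-n)
  map_add' f g := by simp
  map_smul' r f := by simp

/-- The mode `W*_n`, defined by `W*(z) = ∑ₙ W*_n zⁿ`. -/
def WStar (n : ℤ) : Module.End ℚ SymmFn where
  toFun f := (WzStar f).coeff n
  map_add' f g := by simp
  map_smul' r f := by simp

/-- `det (h_{λ_i - i + j} - h_{λ_i - i - j})_{1 ≤ i, j ≤ k}`; the row `λ_i` is `μ.rowLen (i - 1)`,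
and the indices `i`, `j` run from `0` to `k - 1` in the code. -/
def hDet (μ : YoungDiagram) (k : ℕ) : SymmFn :=
  (Matrix.of fun i j : Fin k =>
    h ((μ.rowLen i : ℤ) - i + j) - h ((μ.rowLen i : ℤ) - i - j - 2)).det

/-- `det (e_{λ_i - i + j} + e_{λ_i - i - j + 2})_{1 ≤ i, j ≤ k}`; again the indices `i`, `j` run
from `0` to `k - 1` in the code. -/
def eDet (μ : YoungDiagram) (k : ℕ) : SymmFn :=
  (Matrix.of fun i j : Fin k =>
    e ((μ.rowLen i : ℤ) - i + j) + e ((μ.rowLen i : ℤ) - i - j)).det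

/-- The orthogonal Schur function `o_λ`; the size of the determinant is the length of `λ`. -/
def orthoSchur (μ : YoungDiagram) : SymmFn := hDet μ (μ.colLen 0)

/-- `λ = (α | β)` in Frobenius notation with `r` boxes on the main diagonal:
`α_i = λ_i - i` and `β_i = λ'_i - i` for `1 ≤ i ≤ r`. -/
structure IsFrobenius (μ : YoungDiagram) (r : ℕ) (α β : Fin r → ℕ) : Prop where
  diag : ∀ i : ℕ, (i, i) ∈ μ ↔ i < r
  arm : ∀ i : Fin r, (μ.rowLen i : ℤ) - (i + 1) = α i
  leg : ∀ i : Fin r, (μ.colLen i : ℤ) - (i + 1) = β i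

end SymFun

end

noncomputable section

namespace SymFun

open scoped LaurentPolynomial

/-! For t = ±1 the operator exp(t ∑ (zⁿ + z⁻ⁿ) ∂/∂p_n) is the exponential of a locally nilpotent
derivation, hence the ring homomorphism p_n ↦ p_n + t(zⁿ + z⁻ⁿ). On the series ∑ h_n uⁿ = exp(∑ p_n
uⁿ/n) and ∑ (-1)ⁿ e_n uⁿ = exp(-∑ p_n uⁿ/n) it multiplies or divides by (1 - zu)(1 - z⁻¹u) = 1 - (z
+ z⁻¹)u + u². Everything rests on these rules.

Fermions. The rules tell how modes pass multiplication by h_n or e_n. Either family generates Λ, so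
a relation between modes follows from its value at 1 and its stability under such multiplications.
With A_m = W_{-m} and B_m = W*_m this yields A_m A_n = -A_{n-1} A_{m+1}, the same for B, and A_m
B_{n-1} + B_n A_{m-1} = δ_{m+n,1}; moreover A_0 and B_0 fix 1, and negative indices kill it
(`isFermionPair`).

Duality. By these relations A_{1-n} B_n adds to a word A_{λ_1} ⋯ A_{λ_k}.1 a box of content -n. It
also equals -B_{1+n} A_{-n}, which does the same to words in B with the conjugate shape. Building λ
box by box turns the A-word of λ into (-1)^{|λ|} times the B-word of λ'
(`IsFermionPair.word_eq_word`). Applied only to the rows below the Durfee square, this gives the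
Frobenius formulas.

Determinants. The substitution turns each row of the determinant into a three-term combination in z
+ z⁻¹. The result is a bordered determinant after unitriangular column operations that clear its top
row but for one entry, so each mode puts one new row on top (`word_one_eq_det`). Column j carries a
Chebyshev polynomial in z + z⁻¹: the second kind gives the differences of h's, the first kind the
sums of e's. In the latter the first column is doubled, whence the factor 1/2. -/

/-! ### Exponential series and the functions h_n, e_n -/

open PowerSeries in
-- The equation f' = af determines (n+1)f_{n+1} from f_0, …, f_n, and n+1 is a unit in a ℚ-algebra.
-- This stands in for taking logarithms when exponential series are compared.
theorem powerSeries_eq_of_derivative_eq_mul {R : Type*} [CommRing R] [Algebra ℚ R]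
    {a f g : R⟦X⟧} (hf : derivative R f = a * f) (hg : derivative R g = a * g)
    (h0 : constantCoeff f = constantCoeff g) : f = g := by
  ext n
  induction n using Nat.strong_induction_on with
  | _ n ih =>
    rcases n with _ | n
    · simpa using h0
    · have key : coeff (n + 1) f * (n + 1) = coeff (n + 1) g * (n + 1) := by
        rw [← coeff_derivative, ← coeff_derivative, hf, hg, coeff_mul, coeff_mul]
        refine Finset.sum_congr rfl fun x hx => ?_
        rw [Finset.HasAntidiagonal.mem_antidiagonal] at hx
        rw [ih x.2 (by omega)]
      have hu : IsUnit ((n : R) + 1) := by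
        have := (IsUnit.mk0 ((n : ℚ) + 1) (by positivity)).map (algebraMap ℚ R)
        simpa using this
      exact hu.mul_right_cancel key

/-- Moves the exponential from ℚ to Λ, so that the outer and inner series share a coefficient ring
when the chain rule is applied. -/
theorem expMul_eq (s : ℚ) : expMul s = (PowerSeries.exp SymmFn).subst
    (PowerSeries.mk fun n => if h : 0 < n then (s / (n : ℚ)) • p ⟨n, h⟩ else 0 :
      PowerSeries SymmFn) := by
  have hs : PowerSeries.HasSubst (PowerSeries.mk fun n => if h : 0 < n then
      (s / (n : ℚ)) • p ⟨n, h⟩ else 0 : PowerSeries SymmFn) :=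
    .of_constantCoeff_zero' (by simp [← PowerSeries.coeff_zero_eq_constantCoeff_apply])
  ext1 n
  rw [expMul, PowerSeries.coeff_subst' hs, PowerSeries.coeff_subst' hs]
  refine finsum_congr fun d => ?_
  rw [PowerSeries.coeff_exp, PowerSeries.coeff_exp, algebraMap_smul]
  exact (algebraMap_smul SymmFn _ _).symm

/-- The series `∑_{n ≥ 0} p_{n+1} zⁿ`, the logarithmic derivative of `∑ h_n zⁿ`. -/
def powerSumSeries : PowerSeries SymmFn := PowerSeries.mk fun n => p n.succPNat

theorem derivative_expMul (s : ℚ) : PowerSeries.derivative SymmFn (expMul s) =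
    (s • powerSumSeries) * expMul s := by
  have hs : PowerSeries.HasSubst (PowerSeries.mk fun n => if h : 0 < n then
      (s / (n : ℚ)) • p ⟨n, h⟩ else 0 : PowerSeries SymmFn) :=
    .of_constantCoeff_zero' (by simp [← PowerSeries.coeff_zero_eq_constantCoeff_apply])
  rw [expMul_eq, PowerSeries.derivative_subst hs, PowerSeries.derivative_exp, mul_comm]
  congr 1
  ext1 n
  rw [PowerSeries.coeff_derivative, PowerSeries.coeff_mk, dif_pos n.succ_pos,
    PowerSeries.coeff_smul, powerSumSeries, PowerSeries.coeff_mk]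
  have : ((n : SymmFn) + 1) = algebraMap ℚ SymmFn ((n : ℚ) + 1) := by simp
  rw [this, mul_comm, ← Algebra.smul_def, smul_smul]
  congr 1
  push_cast
  field_simp

theorem constantCoeff_expMul (s : ℚ) : PowerSeries.constantCoeff (expMul s) = 1 := by
  have h0 : PowerSeries.constantCoeff (PowerSeries.mk fun n => if h : 0 < n then
      (s / (n : ℚ)) • p ⟨n, h⟩ else 0 : PowerSeries SymmFn) = 0 := by
    simp [← PowerSeries.coeff_zero_eq_constantCoeff_apply]
  rw [expMul_eq]
  rw [← sub_eq_zero]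
  have := PowerSeries.constantCoeff_subst_eq_zero (R := SymmFn) h0 (PowerSeries.exp SymmFn - 1)
    (by simp)
  rw [PowerSeries.subst_sub (.of_constantCoeff_zero' h0)] at this
  have h1 : PowerSeries.subst (PowerSeries.mk fun n => if h : 0 < n then
      (s / (n : ℚ)) • p ⟨n, h⟩ else 0 : PowerSeries SymmFn) (1 : PowerSeries SymmFn) = 1 := by
    rw [← PowerSeries.coe_substAlgHom (.of_constantCoeff_zero' h0), map_one]
  rw [h1, map_sub, map_one] at this
  exact this

theorem expMul_mul_expMul_neg (s : ℚ) : expMul s * expMul (-s) = 1 := by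
  refine powerSeries_eq_of_derivative_eq_mul (a := 0) ?_ (by simp) ?_
  · rw [Derivation.leibniz, derivative_expMul, derivative_expMul, neg_smul]
    simp only [smul_eq_mul]
    ring
  · rw [map_mul, constantCoeff_expMul, constantCoeff_expMul, mul_one, map_one]

theorem cf_mul (f g : SymmFn) (m : ℕ →₀ ℕ) : cf m (f * g) =
    ∑ x ∈ Finset.HasAntidiagonal.antidiagonal m, cf x.1 f * cf x.2 g := by
  classical
  rw [cf, MulMemClass.coe_mul, MvPowerSeries.coeff_mul]

theorem cf_h (m : ℕ →₀ ℕ) (n : ℤ) : cf m (h n) = if (m.degree : ℤ) = n then 1 else 0 := rfl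

open Classical in
theorem cf_e (m : ℕ →₀ ℕ) (n : ℤ) : cf m (e n) =
    if (m.degree : ℤ) = n ∧ ∀ i, m i ≤ 1 then 1 else 0 := rfl

theorem SymmFn.ext_cf {f g : SymmFn} (H : ∀ m, cf m f = cf m g) : f = g :=
  Subtype.ext (MvPowerSeries.ext H)

theorem cf_sum {ι : Type*} (t : Finset ι) (f : ι → SymmFn) (m : ℕ →₀ ℕ) :
    cf m (∑ i ∈ t, f i) = ∑ i ∈ t, cf m (f i) := by
  simp [cf]

/-- A monomial of p_k dividing x^m is x_i^k with m_i ≥ k; the cofactor is then determined, and h_j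
contains it once if its degree is j. -/
theorem cf_p_mul_h (k : ℕ+) (j : ℕ) (m : ℕ →₀ ℕ) : cf m (p k * h j) =
    if m.degree = k + j then ∑ i ∈ m.support, if (k : ℕ) ≤ m i then 1 else 0 else 0 := by
  classical
  rw [cf_mul]
  have h1 : ∀ x ∈ Finset.HasAntidiagonal.antidiagonal m, cf x.1 (p k) * cf x.2 (h j) =
      if m.degree = k + j then
        ∑ i ∈ m.support, if x.1 = Finsupp.single i (k : ℕ) then 1 else 0 else 0 := by
    intro x hx
    rw [Finset.HasAntidiagonal.mem_antidiagonal] at hx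
    have hd : x.1.degree + x.2.degree = m.degree := by rw [← hx, map_add]
    rw [cf, coeff_p, cf_h]
    by_cases he : ∃ i, x.1 = Finsupp.single i (k : ℕ)
    · rw [if_pos he, one_mul]
      obtain ⟨i, hi⟩ := he
      have hk : x.1.degree = k := by rw [hi]; simp
      refine if_congr (by omega) ?_ rfl
      rw [Finset.sum_eq_single i, if_pos hi]
      · intro b _ hb
        rw [if_neg]
        intro hb2
        exact hb (Finsupp.single_left_injective k.pos.ne' (hb2.symm.trans hi))
      · intro hn
        have := congrArg (fun f : ℕ →₀ ℕ => f i) hx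
        simp only [hi, Finsupp.add_apply, Finsupp.single_eq_same] at this
        have hk := k.pos
        rw [Finsupp.notMem_support_iff] at hn
        omega
    · rw [if_neg he, zero_mul]
      push Not at he
      simp [he]
  rw [Finset.sum_congr rfl h1]
  split_ifs
  · rw [Finset.sum_comm]
    refine Finset.sum_congr rfl fun i _ => ?_
    split_ifs with hk
    · rw [Finset.sum_eq_single (Finsupp.single i (k : ℕ), m - Finsupp.single i (k : ℕ))]
      · simp
      · intro x hx hne
        rw [if_neg]
        intro hx1
        rw [Finset.HasAntidiagonal.mem_antidiagonal] at hx
        exact hne (Prod.ext hx1 (by rw [← hx, ← hx1]; simp))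
      · intro H
        exact absurd (Finset.HasAntidiagonal.mem_antidiagonal.mpr
          (add_tsub_cancel_of_le (Finsupp.single_le_iff.mpr hk))) H
    · refine Finset.sum_eq_zero fun x hx => if_neg ?_
      intro hx1
      rw [Finset.HasAntidiagonal.mem_antidiagonal] at hx
      apply hk
      rw [← hx, hx1]
      simp
  · simp

theorem h_zero : h 0 = 1 := by
  classical
  refine SymmFn.ext_cf fun m => ?_
  rw [cf_h, cf, OneMemClass.coe_one, MvPowerSeries.coeff_one]
  exact if_congr (by rw [Nat.cast_eq_zero, Finsupp.degree_eq_zero_iff]) rfl rfl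

theorem e_zero : e 0 = 1 := by
  classical
  refine SymmFn.ext_cf fun m => ?_
  rw [cf_e, cf, OneMemClass.coe_one, MvPowerSeries.coeff_one]
  refine if_congr ?_ rfl rfl
  rw [Nat.cast_eq_zero, Finsupp.degree_eq_zero_iff]
  constructor
  · exact fun H => H.1
  · rintro rfl; simp

/-- Comparing derivatives reduces this to Newton's identity (n+1)h_{n+1} = ∑ p_{i+1} h_{n-i}. At x^m
of degree n+1 the right side counts, for each variable, the powers 1, …, m_i that can be split off,
which totals the degree of m. -/
theorem expMul_one : expMul 1 = PowerSeries.mk fun n : ℕ => h n := by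
  refine powerSeries_eq_of_derivative_eq_mul (derivative_expMul 1) ?_ ?_
  · ext1 n
    rw [PowerSeries.coeff_derivative, PowerSeries.coeff_mk, PowerSeries.coeff_mul, one_smul]
    refine SymmFn.ext_cf fun m => ?_
    simp only [powerSumSeries, PowerSeries.coeff_mk]
    rw [cf_sum, Finset.sum_congr rfl fun x _ => cf_p_mul_h _ _ _]
    have : cf m (h ((n + 1 : ℕ) : ℤ) * ((n : SymmFn) + 1)) =
        cf m (h ((n + 1 : ℕ) : ℤ)) * (n + 1) := by
      rw [show ((n : SymmFn) + 1) = algebraMap ℚ SymmFn ((n : ℚ) + 1) by simp, mul_comm,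
        ← Algebra.smul_def, cf, SetLike.val_smul, MvPowerSeries.coeff_smul, mul_comm]
    rw [this, cf_h]
    by_cases hm : m.degree = n + 1
    · rw [if_pos (by exact_mod_cast hm), one_mul]
      have h2 : ∀ x ∈ Finset.HasAntidiagonal.antidiagonal n,
          (if m.degree = (x.1.succPNat : ℕ) + x.2 then
            ∑ i ∈ m.support, if (x.1.succPNat : ℕ) ≤ m i then (1 : ℚ) else 0 else 0) =
          ∑ i ∈ m.support, if x.1 < m i then 1 else 0 := by
        intro x hx
        rw [Finset.HasAntidiagonal.mem_antidiagonal] at hx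
        rw [if_pos (by simp; omega)]
        rfl
      rw [Finset.sum_congr rfl h2, Finset.sum_comm]
      have h3 : ∀ i ∈ m.support, (∑ x ∈ Finset.HasAntidiagonal.antidiagonal n,
          if x.1 < m i then (1 : ℚ) else 0) = m i := by
        intro i _
        have hle : m i ≤ n + 1 := hm ▸ Finsupp.le_degree i m
        rw [Finset.Nat.sum_antidiagonal_eq_sum_range_succ_mk]
        simp only
        rw [Finset.sum_boole]
        congr 1
        have : (Finset.range n.succ).filter (fun x => x < m i) = Finset.range (m i) := by
          ext x; simp; omega
        rw [this, Finset.card_range]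
      rw [Finset.sum_congr rfl h3, ← Nat.cast_sum, ← Finsupp.degree_apply, hm]
      simp
    · rw [if_neg (by exact_mod_cast hm), zero_mul, Finset.sum_eq_zero]
      intro x hx
      rw [Finset.HasAntidiagonal.mem_antidiagonal] at hx
      rw [if_neg (by simp; omega)]
  · rw [constantCoeff_expMul, ← PowerSeries.coeff_zero_eq_constantCoeff_apply]
    simp [h_zero]

open Classical in
-- Squarefree divisors of x^m are the subsets of its support, and the alternating count of subsets
-- of a nonempty set is zero.
theorem sum_antidiagonal_squarefree {m : ℕ →₀ ℕ} (hm : m ≠ 0) :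
    (∑ x ∈ Finset.HasAntidiagonal.antidiagonal m with ∀ i, x.1 i ≤ 1,
      (-1 : ℚ) ^ x.1.degree) = 0 := by
  have : (∑ t ∈ m.support.powerset, (-1 : ℤ) ^ t.card) = 0 :=
    Finset.sum_powerset_neg_one_pow_card_of_nonempty (Finsupp.support_nonempty_iff.mpr hm)
  have h2 : (∑ t ∈ m.support.powerset, (-1 : ℚ) ^ t.card) = 0 := by exact_mod_cast this
  rw [← h2]
  symm
  have hval : ∀ (t : Finset ℕ) (i : ℕ), (Finsupp.indicator t fun _ _ => 1 : ℕ →₀ ℕ) i =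
      if i ∈ t then 1 else 0 := by
    intro t i; simp [Finsupp.indicator_apply]
  refine Finset.sum_bij' (fun t _ => ((Finsupp.indicator t fun _ _ => 1 : ℕ →₀ ℕ),
    m - Finsupp.indicator t fun _ _ => 1)) (fun x _ => x.1.support) ?_ ?_ ?_ ?_ ?_
  · intro t ht
    rw [Finset.mem_powerset] at ht
    rw [Finset.mem_filter, Finset.HasAntidiagonal.mem_antidiagonal]
    refine ⟨?_, fun i => ?_⟩
    · ext i
      simp only [Finsupp.add_apply, Finsupp.tsub_apply, hval]
      split_ifs with hi
      · have := Finsupp.mem_support_iff.mp (ht hi); omega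
      · omega
    · simp only [hval]; split_ifs <;> simp
  · intro x hx
    rw [Finset.mem_filter, Finset.HasAntidiagonal.mem_antidiagonal] at hx
    rw [Finset.mem_powerset]
    intro i hi
    rw [Finsupp.mem_support_iff] at hi ⊢
    rw [← hx.1, Finsupp.add_apply]
    omega
  · intro t ht
    ext i
    simp [hval]
  · intro x hx
    rw [Finset.mem_filter, Finset.HasAntidiagonal.mem_antidiagonal] at hx
    have h1 : (Finsupp.indicator x.1.support fun _ _ => 1 : ℕ →₀ ℕ) = x.1 := by
      ext i
      rw [hval]
      have := hx.2 i
      simp only [Finsupp.mem_support_iff]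
      split_ifs <;> omega
    ext i
    · simp only [h1]
    · simp only [h1, ← hx.1]; simp
  · intro t ht
    congr 1
    rw [Finsupp.degree_apply, Finset.card_eq_sum_ones]
    have hsupp : (Finsupp.indicator t fun _ _ => 1 : ℕ →₀ ℕ).support = t := by
      ext i; simp [hval]
    rw [hsupp]
    exact Finset.sum_congr rfl fun i hi => by simp [hval, hi]

theorem hSeries_mul_eSeries : (PowerSeries.mk fun n : ℕ => h n) *
    (PowerSeries.mk fun n : ℕ => (-1 : ℚ) ^ n • e n) = 1 := by
  classical
  rw [mul_comm]
  ext1 n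
  rw [PowerSeries.coeff_mul, PowerSeries.coeff_one]
  simp only [PowerSeries.coeff_mk]
  split_ifs with hn
  · subst hn; simp [h_zero, e_zero]
  refine SymmFn.ext_cf fun m => ?_
  rw [cf_sum]
  have h0 : cf m 0 = 0 := by simp [cf]
  rw [h0]
  have h1 : ∀ x : ℕ × ℕ, cf m ((-1 : ℚ) ^ x.1 • e x.1 * h x.2) =
      ∑ y ∈ Finset.HasAntidiagonal.antidiagonal m, if (∀ i, y.1 i ≤ 1) then
        (if y.1.degree = x.1 ∧ y.2.degree = x.2 then (-1 : ℚ) ^ y.1.degree else 0) else 0 := by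
    intro x
    rw [cf_mul]
    refine Finset.sum_congr rfl fun y _ => ?_
    have : cf y.1 ((-1 : ℚ) ^ x.1 • e x.1) = (-1 : ℚ) ^ x.1 * cf y.1 (e x.1) := by
      rw [cf, SetLike.val_smul, MvPowerSeries.coeff_smul]
    rw [this, cf_e, cf_h]
    simp only [Nat.cast_inj]
    by_cases ha : y.1.degree = x.1 <;> by_cases hb : y.2.degree = x.2 <;>
      by_cases hc : ∀ i, y.1 i ≤ 1 <;> simp [ha, hb, hc]
  rw [Finset.sum_congr rfl fun x _ => h1 x, Finset.sum_comm]
  by_cases hm : m.degree = n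
  · have hm0 : m ≠ 0 := by rintro rfl; simp at hm; omega
    refine Eq.trans ?_ (sum_antidiagonal_squarefree hm0)
    rw [Finset.sum_filter]
    refine Finset.sum_congr rfl fun y hy => ?_
    rw [Finset.HasAntidiagonal.mem_antidiagonal] at hy
    split_ifs with hc
    · rw [Finset.sum_eq_single (y.1.degree, y.2.degree)]
      · simp
      · rintro ⟨a, b⟩ _ hab
        rw [if_neg]
        rintro ⟨rfl, rfl⟩
        exact hab rfl
      · intro H
        exact absurd (Finset.HasAntidiagonal.mem_antidiagonal.mpr
          (by rw [← map_add, hy, hm])) H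
    · simp
  · refine Finset.sum_eq_zero fun y hy => Finset.sum_eq_zero fun x hx => ?_
    rw [Finset.HasAntidiagonal.mem_antidiagonal] at hy hx
    split_ifs with hc hd
    · exfalso
      apply hm
      rw [← hy, map_add, hd.1, hd.2, hx]
    · rfl
    · rfl

theorem expMul_neg_one : expMul (-1) = PowerSeries.mk fun n : ℕ => (-1 : ℚ) ^ n • e n := by
  have h1 := expMul_mul_expMul_neg 1
  rw [expMul_one] at h1
  exact (left_inv_eq_right_inv ((mul_comm _ _).trans h1) hSeries_mul_eSeries)

/-! ### The exponential of the shift derivation is a ring homomorphism -/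

theorem powerSumEquiv_X (n : ℕ+) : powerSumEquiv (MvPolynomial.X n) = p n :=
  MvPolynomial.aeval_X _ _

theorem dp_mul (n : ℕ+) (f g : SymmFn) : dp n (f * g) = f * dp n g + dp n f * g := by
  change powerSumEquiv (MvPolynomial.pderiv n (powerSumEquiv.symm (f * g))) =
    f * powerSumEquiv (MvPolynomial.pderiv n (powerSumEquiv.symm g)) +
      powerSumEquiv (MvPolynomial.pderiv n (powerSumEquiv.symm f)) * g
  rw [map_mul, MvPolynomial.pderiv_mul, map_add, map_mul, map_mul, AlgEquiv.apply_symm_apply,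
    AlgEquiv.apply_symm_apply, add_comm]

theorem dp_p (n m : ℕ+) : dp n (p m) = if m = n then 1 else 0 := by
  classical
  change powerSumEquiv (MvPolynomial.pderiv n (powerSumEquiv.symm (p m))) = _
  rw [← powerSumEquiv_X, AlgEquiv.symm_apply_apply, MvPolynomial.pderiv_X, Pi.single_apply]
  split_ifs <;> simp

theorem dp_one (n : ℕ+) : dp n 1 = 0 := by
  have := dp_mul n 1 1
  simpa using this

theorem dpL_C_mul_T (n : ℕ+) (f : SymmFn) (j : ℤ) :
    dpL n (LaurentPolynomial.C f * LaurentPolynomial.T j) =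
      LaurentPolynomial.C (dp n f) * LaurentPolynomial.T j := by
  ext1 i
  rw [coeff_dpL, ← LaurentPolynomial.single_eq_C_mul_T, ← LaurentPolynomial.single_eq_C_mul_T,
    AddMonoidAlgebra.coeff_single, AddMonoidAlgebra.coeff_single, Finsupp.single_apply,
    Finsupp.single_apply]
  split_ifs <;> simp

theorem dpL_mul (n : ℕ+) (f g : SymmFn[T;T⁻¹]) :
    dpL n (f * g) = f * dpL n g + dpL n f * g := by
  induction f using LaurentPolynomial.induction_on' with
  | add f₁ f₂ h₁ h₂ => rw [add_mul, map_add, map_add, h₁, h₂]; ring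
  | C_mul_T i a =>
    induction g using LaurentPolynomial.induction_on' with
    | add g₁ g₂ h₁ h₂ => rw [mul_add, map_add, map_add, h₁, h₂]; ring
    | C_mul_T j b =>
      have : (LaurentPolynomial.C a * LaurentPolynomial.T i) *
          (LaurentPolynomial.C b * LaurentPolynomial.T j) =
          (LaurentPolynomial.C (a * b) * LaurentPolynomial.T (i + j) : SymmFn[T;T⁻¹]) := by
        rw [map_mul, LaurentPolynomial.T_add]; ring
      rw [this, dpL_C_mul_T, dpL_C_mul_T, dpL_C_mul_T, dp_mul, map_add, map_mul, map_mul,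
        LaurentPolynomial.T_add]
      ring

theorem shiftD_mul (f g : SymmFn[T;T⁻¹]) :
    shiftD (f * g) = f * shiftD g + shiftD f * g := by
  change (∑ᶠ n : ℕ+, _) = f * (∑ᶠ n : ℕ+, _) + (∑ᶠ n : ℕ+, _) * g
  rw [mul_finsum' (f := _) (h := finite_terms g), finsum_mul' (f := _) (h := finite_terms f),
    ← finsum_add_distrib]
  · refine finsum_congr fun n => ?_
    rw [dpL_mul]; ring
  · exact (finite_terms g).subset fun n hn h => hn (by simp only at h ⊢; rw [h, mul_zero])
  · exact (finite_terms f).subset fun n hn h => hn (by simp only at h ⊢; rw [h, zero_mul])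

theorem shiftD_C_p (n : ℕ+) : shiftD (LaurentPolynomial.C (p n)) =
    LaurentPolynomial.T (n : ℤ) + LaurentPolynomial.T (-(n : ℤ)) := by
  have h : ∀ m, dpL m (LaurentPolynomial.C (p n)) = if n = m then 1 else 0 := by
    intro m
    have := dpL_C_mul_T m (p n) 0
    rw [LaurentPolynomial.T_zero, mul_one, mul_one, dp_p] at this
    rw [this]
    split_ifs <;> simp
  change (∑ᶠ m : ℕ+, _) = _
  rw [finsum_eq_single _ n]
  · rw [h, if_pos rfl, mul_one]
  · intro m hm
    rw [h, if_neg hm.symm, mul_zero]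

theorem shiftD_T (j : ℤ) : shiftD (LaurentPolynomial.T j) = 0 := by
  change (∑ᶠ m : ℕ+, _) = _
  rw [← finsum_zero]
  refine finsum_congr fun m => ?_
  have := dpL_C_mul_T m 1 j
  rw [dp_one, map_one, one_mul, map_zero, zero_mul] at this
  rw [this, mul_zero]

/-- The exponential series of `s • shiftD` at `f`, as a polynomial whose value at `1` is
`expShift s f`. -/
theorem exists_expPoly (s : ℚ) (f : SymmFn) : ∃ q : Polynomial (SymmFn[T;T⁻¹]),
    (∀ k, q.coeff k = (s ^ k / (k.factorial : ℚ)) • (shiftD ^ k) (LaurentPolynomial.C f)) ∧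
      q.eval 1 = expShift s f := by
  have hfin := finite_pow f fun k => s ^ k / (k.factorial : ℚ)
  let q : Polynomial (SymmFn[T;T⁻¹]) := ∑ k ∈ hfin.toFinset, Polynomial.monomial k
    ((s ^ k / (k.factorial : ℚ)) • (shiftD ^ k) (LaurentPolynomial.C f))
  refine ⟨q, fun k => ?_, ?_⟩
  · simp only [q, Polynomial.finsetSum_coeff, Polynomial.coeff_monomial]
    rw [Finset.sum_ite_eq']
    split_ifs with hk
    · rfl
    · rw [Set.Finite.mem_toFinset, Function.mem_support, not_not] at hk
      exact hk.symm
  · simp only [q, Polynomial.eval_finsetSum, Polynomial.eval_monomial, one_pow, mul_one]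
    exact (finsum_eq_sum _ hfin).symm

open Finset in
theorem shiftD_pow_mul (n : ℕ) (f g : SymmFn[T;T⁻¹]) : (shiftD ^ n) (f * g) =
    ∑ x ∈ HasAntidiagonal.antidiagonal n,
      n.choose x.1 • ((shiftD ^ x.1) f * (shiftD ^ x.2) g) := by
  induction n with
  | zero => simp
  | succ n ih =>
    rw [sum_antidiagonal_choose_succ_nsmul
      (M := SymmFn[T;T⁻¹]) (fun i j => (shiftD ^ i) f * (shiftD ^ j) g) n]
    simp only [pow_succ', Module.End.mul_apply, ih, map_sum, map_nsmul, shiftD_mul, smul_add,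
      sum_add_distrib, add_right_inj]
    refine sum_congr rfl fun ⟨i, j⟩ hij ↦ ?_
    rw [n.choose_symm_of_eq_add (HasAntidiagonal.mem_antidiagonal.1 hij).symm]

/-- For a derivation D the divided powers Dᵏ/k! satisfy the Leibniz rule without binomial
coefficients. This is the product rule for coefficients of polynomials in an auxiliary variable,
which is then set to 1. -/
theorem expShift_mul (s : ℚ) (f g : SymmFn) :
    expShift s (f * g) = expShift s f * expShift s g := by
  obtain ⟨q, hq, hq1⟩ := exists_expPoly s f
  obtain ⟨r, hr, hr1⟩ := exists_expPoly s g
  obtain ⟨u, hu, hu1⟩ := exists_expPoly s (f * g)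
  rw [← hq1, ← hr1, ← hu1, ← Polynomial.eval_mul]
  congr 1
  ext1 k
  rw [hu, Polynomial.coeff_mul, map_mul, shiftD_pow_mul, Finset.smul_sum]
  refine Finset.sum_congr rfl fun x hx => ?_
  rw [Finset.HasAntidiagonal.mem_antidiagonal] at hx
  rw [hq, hr, ← Nat.cast_smul_eq_nsmul ℚ, smul_smul, smul_mul_smul_comm]
  congr 1
  rw [← hx, Nat.choose_symm_add, Nat.add_choose,
    Nat.cast_div (Nat.factorial_mul_factorial_dvd_factorial_add _ _)
    (by positivity)]
  push_cast
  field_simp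
  ring

theorem expShift_p (s : ℚ) (n : ℕ+) : expShift s (p n) = LaurentPolynomial.C (p n) +
    s • (LaurentPolynomial.T (n : ℤ) + LaurentPolynomial.T (-(n : ℤ))) := by
  change (∑ᶠ k : ℕ, _) = _
  -- The derivation sends p_n to zⁿ + z⁻ⁿ, which it kills in turn, so only the terms k = 0, 1
  -- remain.
  rw [finsum_eq_sum_of_support_subset (s := Finset.range 2)]
  · rw [Finset.sum_range_succ, Finset.sum_range_one]
    simp [shiftD_C_p]
  · intro k hk
    rw [Finset.coe_range, Set.mem_Iio]
    by_contra hlt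
    obtain ⟨l, rfl⟩ : ∃ l, k = l + 2 := ⟨k - 2, by omega⟩
    apply hk
    simp only
    rw [pow_add shiftD, Module.End.mul_apply, pow_two shiftD, Module.End.mul_apply, shiftD_C_p,
      map_add, shiftD_T, shiftD_T, add_zero, map_zero, smul_zero]

theorem expShift_one (s : ℚ) : expShift s 1 = 1 := by
  change (∑ᶠ k : ℕ, _) = _
  rw [finsum_eq_single _ 0]
  · simp
  · intro k hk
    obtain ⟨l, rfl⟩ : ∃ l, k = l + 1 := ⟨k - 1, by omega⟩
    rw [pow_succ shiftD, Module.End.mul_apply, map_one, ← LaurentPolynomial.T_zero, shiftD_T,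
      map_zero, smul_zero]

/-- `expShift` as a homomorphism of algebras. -/
def expShiftHom (s : ℚ) : SymmFn →ₐ[ℚ] SymmFn[T;T⁻¹] :=
  AlgHom.ofLinearMap (expShift s) (expShift_one s) (expShift_mul s)

/-! ### Shifting the power sums multiplies exponential series by a quadratic factor -/

section Quadratic

variable {A R : Type*} [CommRing A] [CommRing R]

/-- The polynomial `(1 - z u) (1 - w u)` in `u`. -/
def quadFactor (z w : R) : PowerSeries R :=
  (1 - PowerSeries.C z * PowerSeries.X) * (1 - PowerSeries.C w * PowerSeries.X)

theorem mk_pow_mul (z : R) : (PowerSeries.mk fun n : ℕ => z ^ (n + 1)) *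
    (1 - PowerSeries.C z * PowerSeries.X) = PowerSeries.C z := by
  ext1 n
  rw [mul_sub, mul_one, mul_left_comm, ← mul_assoc, map_sub]
  rcases n with _ | n
  · simp
  · rw [mul_assoc, PowerSeries.coeff_C_mul, PowerSeries.coeff_succ_mul_X, PowerSeries.coeff_mk,
      PowerSeries.coeff_mk, PowerSeries.coeff_C, if_neg (by simp), pow_succ' z (n + 1), sub_self]

/-- The series `∑ (z^{n+1} + w^{n+1}) uⁿ`. -/
def shiftSeries (z w : R) : PowerSeries R := PowerSeries.mk fun n : ℕ => z ^ (n + 1) + w ^ (n + 1)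

/-- This is the logarithmic form of (1 - zu)(1 - wu) = exp(-∑ (zⁿ + wⁿ) uⁿ/n). -/
theorem derivative_quadFactor (z w : R) :
    PowerSeries.derivative R (quadFactor z w) = -shiftSeries z w * quadFactor z w := by
  have h : shiftSeries z w = (PowerSeries.mk fun n : ℕ => z ^ (n + 1)) +
      PowerSeries.mk fun n : ℕ => w ^ (n + 1) := by
    ext1 n
    simp [shiftSeries]
  have h1 := mk_pow_mul z
  have h2 := mk_pow_mul w
  rw [h, quadFactor, Derivation.leibniz, map_sub, map_sub, Derivation.leibniz, Derivation.leibniz,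
    PowerSeries.derivative_C, PowerSeries.derivative_C, PowerSeries.derivative_X,
    PowerSeries.derivative_one]
  simp only [smul_eq_mul]
  linear_combination (1 - PowerSeries.C w * PowerSeries.X) * h1 +
    (1 - PowerSeries.C z * PowerSeries.X) * h2

theorem constantCoeff_quadFactor (z w : R) : PowerSeries.constantCoeff (quadFactor z w) = 1 := by
  simp [quadFactor]

/-- When zw = 1 the factor is 1 - (z + w)u + u². -/
theorem coeff_mul_quadFactor {z w : R} (hzw : z * w = 1) (f : PowerSeries R) (n : ℕ) :
    PowerSeries.coeff n (f * quadFactor z w) = PowerSeries.coeff n f -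
      (z + w) * (if 1 ≤ n then PowerSeries.coeff (n - 1) f else 0) +
      (if 2 ≤ n then PowerSeries.coeff (n - 2) f else 0) := by
  have h2 : f * quadFactor z w = f - PowerSeries.C (z + w) *
      (f * PowerSeries.X ^ 1) + f * PowerSeries.X ^ 2 := by
    have := congrArg (PowerSeries.C (R := R)) hzw
    rw [map_mul, map_one] at this
    rw [quadFactor, map_add]
    linear_combination (f * PowerSeries.X ^ 2) * this
  rw [h2, map_add, map_sub, PowerSeries.coeff_C_mul, PowerSeries.coeff_mul_X_pow',
    PowerSeries.coeff_mul_X_pow']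

theorem derivative_map (φ : A →+* R) (f : PowerSeries A) :
    PowerSeries.derivative R (f.map φ) = (PowerSeries.derivative A f).map φ := by
  ext1 n
  simp [PowerSeries.coeff_derivative]

variable [Algebra ℚ A] [Algebra ℚ R]

theorem derivative_map_of_eq_smul_mul (φ : A →+* R) {s : ℚ} {a c : PowerSeries A}
    (hc : PowerSeries.derivative A c = (s • a) * c) :
    PowerSeries.derivative R (c.map φ) = (s • a.map φ) * c.map φ := by
  rw [derivative_map, hc, map_mul]
  congr 1
  ext1 n
  rw [PowerSeries.coeff_map, PowerSeries.coeff_smul, PowerSeries.coeff_smul,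
    PowerSeries.coeff_map, map_rat_smul]

/-- Here c is the exponential of s times the integral of a, so shifting a by t(zⁿ⁺¹ + wⁿ⁺¹)
multiplies c by the power -st of the quadratic factor. The case st = 1, where the factor ends up on
the other side, is `map_mul_quadFactor_eq_map`. -/
theorem map_eq_map_mul_quadFactor {φ ι : A →+* R} {s t : ℚ} {a c : PowerSeries A} {z w : R}
    (hc : PowerSeries.derivative A c = (s • a) * c)
    (h1 : PowerSeries.constantCoeff c = 1)
    (ha : a.map φ = a.map ι + t • shiftSeries z w) (hst : s * t = -1) :
    c.map φ = c.map ι * quadFactor z w := by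
  refine powerSeries_eq_of_derivative_eq_mul (derivative_map_of_eq_smul_mul φ hc) ?_ ?_
  · rw [Derivation.leibniz, derivative_map_of_eq_smul_mul ι hc, derivative_quadFactor, ha,
      smul_add, smul_smul, hst, neg_one_smul]
    simp only [smul_eq_mul]
    ring
  · rw [map_mul, constantCoeff_quadFactor, ← PowerSeries.coeff_zero_eq_constantCoeff_apply,
      ← PowerSeries.coeff_zero_eq_constantCoeff_apply, PowerSeries.coeff_map, PowerSeries.coeff_map,
      PowerSeries.coeff_zero_eq_constantCoeff_apply, h1, map_one, map_one, mul_one]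

theorem map_mul_quadFactor_eq_map {φ ι : A →+* R} {s t : ℚ} {a c : PowerSeries A} {z w : R}
    (hc : PowerSeries.derivative A c = (s • a) * c)
    (h1 : PowerSeries.constantCoeff c = 1)
    (ha : a.map φ = a.map ι + t • shiftSeries z w) (hst : s * t = 1) :
    c.map φ * quadFactor z w = c.map ι := by
  refine powerSeries_eq_of_derivative_eq_mul ?_ (derivative_map_of_eq_smul_mul ι hc) ?_
  · rw [Derivation.leibniz, derivative_map_of_eq_smul_mul φ hc, derivative_quadFactor, ha,
      smul_add, smul_smul, hst, one_smul]
    simp only [smul_eq_mul]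
    ring
  · rw [map_mul, constantCoeff_quadFactor, ← PowerSeries.coeff_zero_eq_constantCoeff_apply,
      ← PowerSeries.coeff_zero_eq_constantCoeff_apply, PowerSeries.coeff_map, PowerSeries.coeff_map,
      PowerSeries.coeff_zero_eq_constantCoeff_apply, h1, map_one, map_one, mul_one]

theorem coeff_map_eq_of_neg_one {φ ι : A →+* R} {s t : ℚ} {a c : PowerSeries A} {z w : R}
    (hzw : z * w = 1) (hc : PowerSeries.derivative A c = (s • a) * c)
    (h1 : PowerSeries.constantCoeff c = 1)
    (ha : a.map φ = a.map ι + t • shiftSeries z w) (hst : s * t = -1) (n : ℕ) :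
    φ (PowerSeries.coeff n c) = ι (PowerSeries.coeff n c) -
      (z + w) * ι (if 1 ≤ n then PowerSeries.coeff (n - 1) c else 0) +
      ι (if 2 ≤ n then PowerSeries.coeff (n - 2) c else 0) := by
  have := congrArg (PowerSeries.coeff n) (map_eq_map_mul_quadFactor hc h1 ha hst)
  rw [coeff_mul_quadFactor hzw] at this
  simpa only [PowerSeries.coeff_map, apply_ite ι, map_zero] using this

theorem coeff_map_eq_of_one {φ ι : A →+* R} {s t : ℚ} {a c : PowerSeries A} {z w : R}
    (hzw : z * w = 1) (hc : PowerSeries.derivative A c = (s • a) * c)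
    (h1 : PowerSeries.constantCoeff c = 1)
    (ha : a.map φ = a.map ι + t • shiftSeries z w) (hst : s * t = 1) (n : ℕ) :
    φ (PowerSeries.coeff n c) -
      (z + w) * φ (if 1 ≤ n then PowerSeries.coeff (n - 1) c else 0) +
      φ (if 2 ≤ n then PowerSeries.coeff (n - 2) c else 0) = ι (PowerSeries.coeff n c) := by
  have := congrArg (PowerSeries.coeff n) (map_mul_quadFactor_eq_map hc h1 ha hst)
  rw [coeff_mul_quadFactor hzw] at this
  simpa only [PowerSeries.coeff_map, apply_ite φ, map_zero] using this

end Quadratic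

theorem map_expShift_powerSumSeries (t : ℚ) :
    powerSumSeries.map (expShiftHom t : SymmFn →+* SymmFn[T;T⁻¹]) =
      powerSumSeries.map LaurentPolynomial.C +
        t • shiftSeries (LaurentPolynomial.T 1) (LaurentPolynomial.T (-1)) := by
  ext1 n
  rw [PowerSeries.coeff_map, map_add, PowerSeries.coeff_map, PowerSeries.coeff_smul,
    powerSumSeries, shiftSeries, PowerSeries.coeff_mk, PowerSeries.coeff_mk,
    LaurentPolynomial.T_pow, LaurentPolynomial.T_pow]
  refine (expShift_p t _).trans ?_
  simp [add_comm]

theorem T_mul_T_neg : (LaurentPolynomial.T 1 * LaurentPolynomial.T (-1) : SymmFn[T;T⁻¹]) = 1 := by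
  rw [← LaurentPolynomial.T_add]; simp

/-- The coefficient of `zⁿ` in `exp (s ∑ p_n zⁿ / n)`, for every integer `n`. -/
def expCoeff (s : ℚ) (n : ℤ) : SymmFn :=
  (HahnSeries.ofPowerSeries ℤ SymmFn (expMul s)).coeff n

theorem expCoeff_natCast (s : ℚ) (n : ℕ) : expCoeff s n = PowerSeries.coeff n (expMul s) :=
  HahnSeries.ofPowerSeries_apply_coeff _ _

theorem expCoeff_of_neg (s : ℚ) {n : ℤ} (hn : n < 0) : expCoeff s n = 0 := by
  rw [expCoeff, HahnSeries.ofPowerSeries_apply, HahnSeries.embDomain_of_notMem_range]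
  rintro ⟨m, hm⟩
  simp at hm
  omega

theorem expCoeff_zero (s : ℚ) : expCoeff s 0 = 1 := by
  have := expCoeff_natCast s 0
  rw [Nat.cast_zero] at this
  rw [this, PowerSeries.coeff_zero_eq_constantCoeff_apply, constantCoeff_expMul]

theorem expCoeff_one (n : ℤ) : expCoeff 1 n = h n := by
  rcases lt_or_ge n 0 with hn | hn
  · rw [expCoeff_of_neg _ hn]
    refine SymmFn.ext_cf fun m => ?_
    rw [cf_h, if_neg (by omega)]
    simp [cf]
  · lift n to ℕ using hn
    rw [expCoeff_natCast, expMul_one, PowerSeries.coeff_mk]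

theorem expCoeff_neg_one (n : ℤ) : expCoeff (-1) n = (-1 : ℚ) ^ n • e n := by
  rcases lt_or_ge n 0 with hn | hn
  · rw [expCoeff_of_neg _ hn]
    have : e n = 0 := by
      refine SymmFn.ext_cf fun m => ?_
      rw [cf_e, if_neg (by omega)]
      simp [cf]
    rw [this, smul_zero]
  · lift n to ℕ using hn
    rw [expCoeff_natCast, expMul_neg_one, PowerSeries.coeff_mk, zpow_natCast]

theorem expCoeff_sub (s : ℚ) (n k : ℕ) : expCoeff s ((n : ℤ) - k) =
    if k ≤ n then PowerSeries.coeff (n - k) (expMul s) else 0 := by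
  split_ifs with hk
  · rw [← Nat.cast_sub hk, expCoeff_natCast]
  · exact expCoeff_of_neg _ (by omega)

theorem expShift_expCoeff {s t : ℚ} (hst : s * t = -1) (n : ℤ) :
    expShift t (expCoeff s n) = LaurentPolynomial.C (expCoeff s n) -
      (LaurentPolynomial.T 1 + LaurentPolynomial.T (-1)) *
        LaurentPolynomial.C (expCoeff s (n - 1)) + LaurentPolynomial.C (expCoeff s (n - 2)) := by
  rcases lt_or_ge n 0 with hn | hn
  · simp [expCoeff_of_neg s hn, expCoeff_of_neg s (n := n - 1) (by omega),
      expCoeff_of_neg s (n := n - 2) (by omega)]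
  · lift n to ℕ using hn
    have := coeff_map_eq_of_neg_one (φ := (expShiftHom t : SymmFn →+* SymmFn[T;T⁻¹]))
      (ι := LaurentPolynomial.C) T_mul_T_neg (derivative_expMul s)
      (constantCoeff_expMul s) (map_expShift_powerSumSeries t) hst n
    have e1 := expCoeff_sub s n 1
    have e2 := expCoeff_sub s n 2
    rw [Nat.cast_one] at e1
    rw [Nat.cast_two] at e2
    rw [e1, e2, expCoeff_natCast]
    exact this

/-- The shift now divides by the quadratic factor, so the individual images are infinite expansions
in general; only this combination is simple. -/
theorem expShift_expCoeff_comb {s t : ℚ} (hst : s * t = 1) (n : ℤ) :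
    expShift t (expCoeff s n) - (LaurentPolynomial.T 1 + LaurentPolynomial.T (-1)) *
        expShift t (expCoeff s (n - 1)) + expShift t (expCoeff s (n - 2)) =
      LaurentPolynomial.C (expCoeff s n) := by
  rcases lt_or_ge n 0 with hn | hn
  · simp [expCoeff_of_neg s hn, expCoeff_of_neg s (n := n - 1) (by omega),
      expCoeff_of_neg s (n := n - 2) (by omega)]
  · lift n to ℕ using hn
    have := coeff_map_eq_of_one (φ := (expShiftHom t : SymmFn →+* SymmFn[T;T⁻¹]))
      (ι := LaurentPolynomial.C) T_mul_T_neg (derivative_expMul s)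
      (constantCoeff_expMul s) (map_expShift_powerSumSeries t) hst n
    have e1 := expCoeff_sub s n 1
    have e2 := expCoeff_sub s n 2
    rw [Nat.cast_one] at e1
    rw [Nat.cast_two] at e2
    rw [e1, e2, expCoeff_natCast]
    exact this

/-! ### Laurent series and the modes of the vertex operators -/

section LaurentSeries

variable {R : Type*} [CommRing R]

theorem coeff_single_one_mul (i : ℤ) (x : LaurentSeries R) (m : ℤ) :
    (HahnSeries.single i (1 : R) * x).coeff m = x.coeff (m - i) := by
  have := HahnSeries.coeff_single_mul_add (r := (1 : R)) (x := x) (a := m - i) (b := i)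
  rwa [sub_add_cancel, one_mul] at this

theorem coeff_C_mul (a : R) (x : LaurentSeries R) (m : ℤ) :
    (HahnSeries.C a * x).coeff m = a * x.coeff m := by
  rw [HahnSeries.C_mul_eq_smul, HahnSeries.coeff_smul, smul_eq_mul]

theorem ofFinsupp_C_mul_T (a : R) (i : ℤ) : (HahnSeries.ofFinsupp
    (LaurentPolynomial.C a * LaurentPolynomial.T i : R[T;T⁻¹]).coeff : LaurentSeries R) =
      HahnSeries.single i a := by
  ext m
  rw [HahnSeries.coeff_ofFinsupp, ← LaurentPolynomial.single_eq_C_mul_T,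
    AddMonoidAlgebra.coeff_single]
  by_cases h : m = i
  · rw [h, Finsupp.single_eq_same, HahnSeries.coeff_single_same]
  · rw [Finsupp.single_eq_of_ne h, HahnSeries.coeff_single_of_ne h]

theorem ofFinsupp_coeff_add (f g : R[T;T⁻¹]) : (HahnSeries.ofFinsupp (f + g).coeff :
    LaurentSeries R) = HahnSeries.ofFinsupp f.coeff + HahnSeries.ofFinsupp g.coeff := by
  ext m; simp

theorem ofFinsupp_coeff_mul (f g : R[T;T⁻¹]) : (HahnSeries.ofFinsupp (f * g).coeff :
    LaurentSeries R) = HahnSeries.ofFinsupp f.coeff * HahnSeries.ofFinsupp g.coeff := by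
  induction f using LaurentPolynomial.induction_on' with
  | add f₁ f₂ h₁ h₂ => rw [add_mul, ofFinsupp_coeff_add, ofFinsupp_coeff_add, h₁, h₂, add_mul]
  | C_mul_T i a =>
    induction g using LaurentPolynomial.induction_on' with
    | add g₁ g₂ h₁ h₂ => rw [mul_add, ofFinsupp_coeff_add, ofFinsupp_coeff_add, h₁, h₂, mul_add]
    | C_mul_T j b =>
      have : (LaurentPolynomial.C a * LaurentPolynomial.T i) *
          (LaurentPolynomial.C b * LaurentPolynomial.T j) =
          (LaurentPolynomial.C (a * b) * LaurentPolynomial.T (i + j) : R[T;T⁻¹]) := by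
        rw [map_mul, LaurentPolynomial.T_add]; ring
      rw [this, ofFinsupp_C_mul_T, ofFinsupp_C_mul_T, ofFinsupp_C_mul_T,
        HahnSeries.single_mul_single]

/-- The inclusion of Laurent polynomials into Laurent series. -/
def laurentHom : R[T;T⁻¹] →+* LaurentSeries R where
  toFun f := HahnSeries.ofFinsupp f.coeff
  map_zero' := by simp
  map_one' := by
    have := ofFinsupp_C_mul_T (1 : R) 0
    rwa [map_one, one_mul, LaurentPolynomial.T_zero] at this
  map_add' := ofFinsupp_coeff_add
  map_mul' := ofFinsupp_coeff_mul

theorem laurentHom_C (a : R) : laurentHom (LaurentPolynomial.C a) = HahnSeries.C a := by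
  have := ofFinsupp_C_mul_T a 0
  rwa [LaurentPolynomial.T_zero, mul_one] at this

theorem laurentHom_T (i : ℤ) : laurentHom (LaurentPolynomial.T i : R[T;T⁻¹]) =
    HahnSeries.single i 1 := by
  have := ofFinsupp_C_mul_T (1 : R) i
  rwa [map_one, one_mul] at this

/-- The Laurent polynomial `z + z⁻¹`. -/
def zAddInv : LaurentSeries R := HahnSeries.single 1 1 + HahnSeries.single (-1) 1

theorem coeff_zAddInv_mul (x : LaurentSeries R) (m : ℤ) :
    (zAddInv * x).coeff m = x.coeff (m - 1) + x.coeff (m + 1) := by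
  rw [zAddInv, add_mul, HahnSeries.coeff_add, coeff_single_one_mul, coeff_single_one_mul,
    sub_neg_eq_add]

end LaurentSeries

/-- The substitution `p_n ↦ p_n + t (zⁿ + z⁻ⁿ)` with values in Laurent series. -/
def shiftHom (t : ℚ) : SymmFn →+* LaurentSeries SymmFn :=
  laurentHom.comp (expShiftHom t : SymmFn →+* SymmFn[T;T⁻¹])

theorem vertex_apply (s : ℚ) (f : SymmFn) : vertex s f =
    HahnSeries.ofPowerSeries ℤ SymmFn (expMul s) * shiftHom (-s) f := rfl

theorem shiftHom_expCoeff {s t : ℚ} (hst : s * t = -1) (n : ℤ) :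
    shiftHom t (expCoeff s n) = HahnSeries.C (expCoeff s n) -
      zAddInv * HahnSeries.C (expCoeff s (n - 1)) + HahnSeries.C (expCoeff s (n - 2)) := by
  have := congrArg laurentHom (expShift_expCoeff hst n)
  rw [map_add, map_sub, map_mul, map_add, laurentHom_C, laurentHom_C, laurentHom_C, laurentHom_T,
    laurentHom_T] at this
  exact this

theorem shiftHom_expCoeff_comb {s t : ℚ} (hst : s * t = 1) (n : ℤ) :
    shiftHom t (expCoeff s n) - zAddInv * shiftHom t (expCoeff s (n - 1)) +
      shiftHom t (expCoeff s (n - 2)) = HahnSeries.C (expCoeff s n) := by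
  have := congrArg laurentHom (expShift_expCoeff_comb hst n)
  rw [map_add, map_sub, map_mul, map_add, laurentHom_C, laurentHom_T, laurentHom_T] at this
  exact this

/-- The modes of `vertex s`. -/
def mode (s : ℚ) (m : ℤ) : SymmFn →ₗ[ℚ] SymmFn where
  toFun f := (vertex s f).coeff m
  map_add' f g := by simp
  map_smul' r f := by simp

theorem mode_apply (s : ℚ) (m : ℤ) (f : SymmFn) : mode s m f = (vertex s f).coeff m := rfl

theorem mode_one (s : ℚ) (m : ℤ) : mode s m 1 = expCoeff s m := by
  rw [mode_apply, vertex_apply, map_one, mul_one, expCoeff]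

/-- The shift is multiplicative, so the factor leaves the vertex operator as its three-term image;
the multiplications by z and z⁻¹ move the index of the mode. -/
theorem mode_expCoeff_mul {s : ℚ} (hs : s * s = 1) (m n : ℤ) (f : SymmFn) :
    mode s m (expCoeff s n * f) = (expCoeff s n + expCoeff s (n - 2)) * mode s m f -
      expCoeff s (n - 1) * (mode s (m - 1) f + mode s (m + 1) f) := by
  have h1 : vertex s (expCoeff s n * f) = HahnSeries.C (expCoeff s n) * vertex s f -
      zAddInv * (HahnSeries.C (expCoeff s (n - 1)) * vertex s f) +
      HahnSeries.C (expCoeff s (n - 2)) * vertex s f := by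
    rw [vertex_apply, vertex_apply, map_mul, shiftHom_expCoeff (by linarith)]
    ring
  simp only [mode_apply]
  rw [h1, HahnSeries.coeff_add, HahnSeries.coeff_sub, coeff_zAddInv_mul, coeff_C_mul, coeff_C_mul,
    coeff_C_mul, coeff_C_mul]
  ring

/-- For the series of opposite sign the quadratic factor sits in the denominator, so the rule is
implicit: it controls only a combination of products by three consecutive coefficients. -/
theorem mode_expCoeff_neg_mul {s : ℚ} (hs : s * s = 1) (m n : ℤ) (f : SymmFn) :
    mode s m (expCoeff (-s) n * f) - mode s (m - 1) (expCoeff (-s) (n - 1) * f) -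
      mode s (m + 1) (expCoeff (-s) (n - 1) * f) + mode s m (expCoeff (-s) (n - 2) * f) =
      expCoeff (-s) n * mode s m f := by
  have h1 : vertex s (expCoeff (-s) n * f) - zAddInv * vertex s (expCoeff (-s) (n - 1) * f) +
      vertex s (expCoeff (-s) (n - 2) * f) = HahnSeries.C (expCoeff (-s) n) * vertex s f := by
    simp only [vertex_apply, map_mul]
    rw [← shiftHom_expCoeff_comb (s := -s) (t := -s) (by linarith)]
    ring
  have := congrArg (fun x : LaurentSeries SymmFn => x.coeff m) h1
  simp only [HahnSeries.coeff_add, HahnSeries.coeff_sub, coeff_zAddInv_mul, coeff_C_mul] at this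
  simp only [mode_apply]
  linear_combination this

theorem expCoeff_newton (s : ℚ) (n : ℕ) : expCoeff s ((n : ℤ) + 1) * (n + 1) =
    ∑ x ∈ Finset.HasAntidiagonal.antidiagonal n, s • p x.1.succPNat * expCoeff s x.2 := by
  have := congrArg (PowerSeries.coeff n) (derivative_expMul s)
  rw [PowerSeries.coeff_derivative, PowerSeries.coeff_mul] at this
  have h1 := expCoeff_natCast s (n + 1)
  rw [Nat.cast_add, Nat.cast_one] at h1
  rw [h1, this]
  refine Finset.sum_congr rfl fun x _ => ?_
  rw [expCoeff_natCast, PowerSeries.coeff_smul, powerSumSeries, PowerSeries.coeff_mk]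

/-- Newton's identity can be solved for p_{n+1} recursively because s is invertible and the zeroth
coefficient is 1. -/
theorem adjoin_expCoeff {s : ℚ} (hs : s ≠ 0) :
    Algebra.adjoin ℚ (Set.range (expCoeff s)) = ⊤ := by
  set S := Algebra.adjoin ℚ (Set.range (expCoeff s)) with hS
  have hc : ∀ n, expCoeff s n ∈ S := fun n => Algebra.subset_adjoin ⟨n, rfl⟩
  have hp : ∀ n : ℕ, p n.succPNat ∈ S := by
    intro n
    induction n using Nat.strong_induction_on with
    | _ n ih =>
      have h1 := expCoeff_newton s n
      rw [Finset.Nat.sum_antidiagonal_eq_sum_range_succ_mk, Finset.sum_range_succ] at h1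
      simp only [Nat.sub_self, Nat.cast_zero, expCoeff_zero, mul_one] at h1
      have h2 : p n.succPNat = s⁻¹ • (expCoeff s ((n : ℤ) + 1) * (n + 1) -
          ∑ i ∈ Finset.range n, s • p i.succPNat * expCoeff s ((n - i : ℕ) : ℤ)) := by
        rw [h1, add_sub_cancel_left, smul_smul, inv_mul_cancel₀ hs, one_smul]
      rw [h2]
      refine S.smul_mem (sub_mem (mul_mem (hc _) (add_mem (natCast_mem S n) (one_mem S)))
        (sum_mem fun i hi => ?_)) _
      exact mul_mem (S.smul_mem (ih i (Finset.mem_range.mp hi)) _) (hc _)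
  rw [eq_top_iff]
  rintro f -
  obtain ⟨Q, rfl⟩ := P_surjective f
  induction Q using MvPolynomial.induction_on with
  | C a => rw [MvPolynomial.algHom_C]; exact S.algebraMap_mem _
  | add a b ha hb => rw [map_add]; exact add_mem ha hb
  | mul_X a i ha =>
    rw [map_mul]
    refine mul_mem ha ?_
    have := hp i.natPred
    rw [PNat.succPNat_natPred] at this
    rwa [P, MvPolynomial.aeval_X]

/-- The induction principle behind the mode relations: a linear condition on f needs checking only
at 1 and under multiplication by the generators. -/
theorem forall_mem_of_expCoeff_mul_mem {s : ℚ} (hs : s ≠ 0) (K : Submodule ℚ SymmFn)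
    (h1 : 1 ∈ K) (hmul : ∀ n, ∀ f ∈ K, expCoeff s n * f ∈ K) (f : SymmFn) : f ∈ K := by
  have key : ∀ g ∈ Algebra.adjoin ℚ (Set.range (expCoeff s)), ∀ f ∈ K, g * f ∈ K := by
    intro g hg
    induction hg using Algebra.adjoin_induction with
    | mem x hx =>
      obtain ⟨n, rfl⟩ := hx
      exact hmul n
    | algebraMap r =>
      intro f hf
      rw [← Algebra.smul_def]
      exact K.smul_mem _ hf
    | add x y _ _ hx hy =>
      intro f hf
      rw [add_mul]
      exact K.add_mem (hx f hf) (hy f hf)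
    | mul x y _ _ hx hy =>
      intro f hf
      rw [mul_assoc]
      exact hx _ (hy f hf)
  rw [← mul_one f]
  exact key f (by rw [adjoin_expCoeff hs]; trivial) 1 h1

/-- At 1 both sides are explicit by `mode_expCoeff_mul`. Multiplication by a generator turns the
relation into a combination of its own instances with shifted indices. -/
theorem mode_mode {s : ℚ} (hs : s * s = 1) (m n : ℤ) (f : SymmFn) :
    mode s m (mode s n f) = -mode s (n - 1) (mode s (m + 1) f) := by
  have hs0 : s ≠ 0 := by rintro rfl; norm_num at hs
  let K : Submodule ℚ SymmFn := ⨅ (m : ℤ) (n : ℤ),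
    LinearMap.ker (mode s m ∘ₗ mode s n + mode s (n - 1) ∘ₗ mode s (m + 1))
  have hK : ∀ f, f ∈ K ↔ ∀ m n, mode s m (mode s n f) + mode s (n - 1) (mode s (m + 1) f) = 0 := by
    intro f
    simp only [K, Submodule.mem_iInf, LinearMap.mem_ker]
    rfl
  have := forall_mem_of_expCoeff_mul_mem hs0 K ?_ ?_ f
  · exact eq_neg_of_add_eq_zero_left ((hK f).mp this m n)
  · rw [hK]
    intro m n
    have h1 := mode_expCoeff_mul hs m n 1
    have h2 := mode_expCoeff_mul hs (n - 1) (m + 1) 1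
    simp only [mul_one, mode_one, add_sub_cancel_right, sub_add_cancel,
      show m + 1 - 2 = m - 1 by ring, show n - 1 - 1 = n - 2 by ring] at h1 h2
    rw [mode_one, mode_one, h1, h2]
    ring
  · intro r f hf
    rw [hK] at hf ⊢
    intro m n
    simp only [mode_expCoeff_mul hs, map_sub, add_mul, mul_add, map_add]
    have e1 : m + 1 - 1 = m := by ring
    have e2 : n - 1 + 1 = n := by ring
    have e3 : n + 1 - 1 = n := by ring
    have e4 : m - 1 + 1 = m := by ring
    have a0 := hf m n
    have a1 := hf (m - 1) n
    have a2 := hf (m + 1) n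
    have a3 := hf m (n - 1)
    have a4 := hf m (n + 1)
    have a5 := hf (m - 1) (n - 1)
    have a6 := hf (m - 1) (n + 1)
    have a7 := hf (m + 1) (n - 1)
    have a8 := hf (m + 1) (n + 1)
    have e5 : r - 1 - 1 = r - 2 := by ring
    have e6 : r - 1 - 2 = r - 3 := by ring
    have e7 : r - 2 - 1 = r - 3 := by ring
    simp only [e1, e2, e3, e4, e5, e6, e7] at *
    -- The weights are the coefficients of u^r in the exponential series times (1 - (z + z⁻¹)u +
    -- u²)(1 - (w + w⁻¹)u + u²), one factor per mode.
    linear_combination (expCoeff s r + 2 * expCoeff s (r - 2) + expCoeff s (r - 2 - 2)) * a0 -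
      (expCoeff s (r - 1) + expCoeff s (r - 3)) * (a1 + a2 + a3 + a4) +
      expCoeff s (r - 2) * (a5 + a6 + a7 + a8)

theorem sum_expCoeff_mul_neg (s : ℚ) (n : ℕ) :
    (∑ i ∈ Finset.range (n + 1), expCoeff s ((n : ℤ) - i) * expCoeff (-s) i) =
      if n = 0 then 1 else 0 := by
  have := congrArg (PowerSeries.coeff n) (expMul_mul_expMul_neg s)
  rw [mul_comm, PowerSeries.coeff_mul, PowerSeries.coeff_one,
    Finset.Nat.sum_antidiagonal_eq_sum_range_succ_mk] at this
  rw [← this]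
  refine Finset.sum_congr rfl fun i hi => ?_
  rw [expCoeff_natCast, expCoeff_sub, if_pos (by simpa [Nat.lt_succ_iff] using hi), mul_comm]

/-! ### The mixed relation between W and W* -/

section Recurrence

variable {R : Type*} [CommRing R] {a b : ℤ → ℤ → R} {c d : ℤ → R}

theorem recurrence_row_zero (hb0 : ∀ m n, m < 0 → b m n = 0) (hd : ∀ n, n < 0 → d n = 0)
    (hcd : ∀ n : ℕ, (∑ i ∈ Finset.range (n + 1), c ((n : ℤ) - i) * d i) = if n = 0 then 1 else 0)
    (hb : ∀ m n, b m n - b (m - 1) (n - 1) - b (m - 1) (n + 1) + b (m - 2) n = c m * d n)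
    (k : ℤ) : b k 0 - b (k - 2) 0 = if k = 0 then 1 else 0 := by
  rcases lt_or_ge k 0 with hk | hk
  · rw [hb0 _ _ hk, hb0 _ _ (by omega), if_neg (by omega), sub_zero]
  -- Grouped as [b(m,n) - b(m-1,n+1)] - [b(m-1,n-1) - b(m-2,n)], the recurrence has zero right side
  -- for n < 0 and propagates the vanishing of the bracket.
  have hL : ∀ N : ℕ, ∀ m : ℤ, m < 0 → b ((N : ℤ) - 1) m - b ((N : ℤ) - 2) (m + 1) = 0 := by
    intro N
    induction N with
    | zero =>
      intro m _
      rw [hb0 _ _ (by simp), hb0 _ _ (by simp), sub_zero]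
    | succ N ih =>
      intro m hm
      have h1 := hb N m
      have h2 := ih (m - 1) (by omega)
      rw [hd m hm] at h1
      rw [sub_add_cancel] at h2
      push_cast
      rw [add_sub_cancel_right, show (N : ℤ) + 1 - 2 = N - 1 by ring]
      linear_combination h1 + h2
  -- Grouped as [b(m,n) - b(m-1,n-1)] - [b(m-1,n+1) - b(m-2,n)], it telescopes to a convolution of c
  -- and d, which is a delta when the second index is 0.
  have hK : ∀ N : ℕ, ∀ m : ℤ, b N m - b ((N : ℤ) - 1) (m - 1) =
      ∑ i ∈ Finset.range (N + 1), c ((N : ℤ) - i) * d (m + i) := by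
    intro N
    induction N with
    | zero =>
      intro m
      have h1 := hb 0 m
      rw [hb0 (0 - 1) _ (by simp), hb0 (0 - 1) _ (by simp), hb0 (0 - 2) _ (by simp)] at h1
      simpa [hb0 (-1) _ (by simp)] using h1
    | succ N ih =>
      intro m
      have h1 := hb (N + 1) m
      have h2 := ih (m + 1)
      rw [Finset.sum_range_succ']
      have h3 : ∀ i ∈ Finset.range (N + 1), c (((N + 1 : ℕ) : ℤ) - ((i + 1 : ℕ) : ℤ)) *
          d (m + ((i + 1 : ℕ) : ℤ)) = c ((N : ℤ) - i) * d (m + 1 + i) := by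
        intro i _
        push_cast
        congr 2 <;> ring
      rw [Finset.sum_congr rfl h3, ← h2]
      rw [add_sub_cancel_right, show (N : ℤ) + 1 - 2 = N - 1 by ring] at h1
      push_cast
      rw [add_sub_cancel_right, sub_zero, add_zero, add_sub_cancel_right]
      linear_combination h1
  lift k to ℕ using hk
  have h1 := hK k 0
  simp only [zero_add] at h1
  rw [hcd] at h1
  have h2 := hL k (-1) (by simp)
  rw [zero_sub] at h1
  rw [neg_add_cancel] at h2
  simp only [Nat.cast_eq_zero]
  linear_combination h1 + h2

/-- The two recurrences have the same right side, so it cancels in x(m,n) = a(m,n-1) + b(m-1,n).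
With the vanishing of x for m, n ≤ 0, this makes x a function of m + n alone, and
`recurrence_row_zero` evaluates it at n = 0, where a drops out. -/
theorem recurrence_sub_eq_delta (ha0 : ∀ m n, n < 0 → a m n = 0) (hb0 : ∀ m n, m < 0 → b m n = 0)
    (hd : ∀ n, n < 0 → d n = 0)
    (hcd : ∀ n : ℕ, (∑ i ∈ Finset.range (n + 1), c ((n : ℤ) - i) * d i) = if n = 0 then 1 else 0)
    (ha : ∀ m n, a m n - a (m - 1) (n - 1) - a (m + 1) (n - 1) + a m (n - 2) = c m * d n)
    (hb : ∀ m n, b m n - b (m - 1) (n - 1) - b (m - 1) (n + 1) + b (m - 2) n = c m * d n)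
    (m n : ℤ) : a m (n - 1) + b (m - 1) n - (a (m - 2) (n - 1) + b (m - 3) n) =
      if m + n = 1 then 1 else 0 := by
  obtain ⟨x, hx⟩ : ∃ x : ℤ → ℤ → R, ∀ m n, x m n = a m (n - 1) + b (m - 1) n :=
    ⟨_, fun _ _ => rfl⟩
  have hx0 : ∀ m n, m ≤ 0 → n ≤ 0 → x m n = 0 := by
    intro m n hm hn
    rw [hx, ha0 _ _ (by omega), hb0 _ _ (by omega), add_zero]
  have hrec : ∀ m n, x m n - x (m + 1) (n - 1) = x (m - 1) (n - 1) - x m (n - 2) := by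
    intro m n
    have h1 := ha m (n - 1)
    have h2 := hb m (n - 1)
    simp only [hx]
    rw [sub_add_cancel] at h2
    rw [add_sub_cancel_right, show m - 1 - 1 = m - 2 by ring, show n - 2 - 1 = n - 1 - 2 by ring]
    rw [show n - 1 - 1 = n - 2 by ring] at h1 h2 ⊢
    linear_combination h1 - h2
  -- The difference x(m,n) - x(m+1,n-1) is constant along the direction (1,1).
  have hy : ∀ N : ℕ, ∀ m n, x m n - x (m + 1) (n - 1) =
      x (m - N) (n - N) - x (m - N + 1) (n - N - 1) := by
    intro N
    induction N with
    | zero => intro m n; simp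
    | succ N ih =>
      intro m n
      rw [ih, hrec]
      push_cast
      congr 2 <;> ring
  have hshift : ∀ m n, x m n = x (m + 1) (n - 1) := by
    intro m n
    -- This many steps make all four indices nonpositive; the extra 1 absorbs the raised first
    -- index.
    have := hy (m.natAbs + n.natAbs + 1) m n
    rw [hx0 (m - ((m.natAbs + n.natAbs + 1 : ℕ) : ℤ)) _ (by omega) (by omega),
      hx0 (m - ((m.natAbs + n.natAbs + 1 : ℕ) : ℤ) + 1) _ (by omega) (by omega), sub_zero] at this
    exact sub_eq_zero.mp this
  have hdiag : ∀ n m, x m n = x (m + n) 0 := by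
    intro n
    induction n using Int.induction_on with
    | zero => intro m; simp
    | succ n ih =>
      intro m
      rw [hshift, add_sub_cancel_right, ih]
      congr 1; ring
    | pred n ih =>
      intro m
      have := hshift (m - 1) (-(n : ℤ))
      rw [sub_add_cancel] at this
      rw [← this, ih]
      congr 1; ring
  have h1 := hdiag n m
  have h2 := hdiag n (m - 2)
  have h3 := recurrence_row_zero hb0 hd hcd hb (m + n - 1)
  rw [hx, hx (m + n), ha0 (m + n) _ (by simp)] at h1
  rw [hx, hx (m - 2 + n), ha0 (m - 2 + n) _ (by simp)] at h2
  rw [show m - 2 - 1 = m - 3 by ring, show m - 2 + n - 1 = m + n - 1 - 2 by ring] at h2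
  rw [h1, h2, zero_add, zero_add, h3]
  exact if_congr (by omega) rfl rfl

end Recurrence

theorem mode_mode_neg_vacuum (m n : ℤ) :
    mode 1 m (expCoeff (-1) (n - 1)) + mode (-1) n (expCoeff 1 (m - 1)) -
      (mode 1 (m - 2) (expCoeff (-1) (n - 1)) + mode (-1) n (expCoeff 1 (m - 3))) =
      if m + n = 1 then 1 else 0 := by
  refine recurrence_sub_eq_delta (a := fun m n => mode 1 m (expCoeff (-1) n))
    (b := fun m n => mode (-1) n (expCoeff 1 m)) (c := expCoeff 1) (d := expCoeff (-1))
    (fun m n hn => ?_) (fun m n hm => ?_) (fun n hn => expCoeff_of_neg _ hn)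
    (sum_expCoeff_mul_neg 1) (fun m n => ?_) (fun m n => ?_) m n
  · simp only [expCoeff_of_neg _ hn, map_zero]
  · simp only [expCoeff_of_neg _ hm, map_zero]
  · have := mode_expCoeff_neg_mul (s := 1) (by norm_num) m n 1
    simp only [mul_one, mode_one] at this
    rw [this, mul_comm]
  · have := mode_expCoeff_neg_mul (s := -1) (by norm_num) n m 1
    simp only [mul_one, mode_one, neg_neg] at this
    rw [← this]

/-- The operator `W_{-m}`. -/
def creation (m : ℤ) : Module.End ℚ SymmFn := mode 1 m - mode 1 (m - 2)

theorem creation_apply (m : ℤ) (f : SymmFn) :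
    creation m f = mode 1 m f - mode 1 (m - 2) f := rfl

/-- The value at 1 is `mode_mode_neg_vacuum`. Passing h_r through W is explicit, but through W* only
implicit, involving h_{r-1} and h_{r-2}; stability under multiplication therefore needs an induction
on r. -/
theorem creation_mode_neg (m n : ℤ) (f : SymmFn) :
    creation m (mode (-1) (n - 1) f) + mode (-1) n (creation (m - 1) f) =
      if m + n = 1 then f else 0 := by
  let K : Submodule ℚ SymmFn := ⨅ (m : ℤ) (n : ℤ),
    LinearMap.ker (creation m ∘ₗ mode (-1) (n - 1) + mode (-1) n ∘ₗ creation (m - 1) -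
      if m + n = 1 then LinearMap.id else 0)
  -- An opaque Kronecker delta, so that the linear combination below treats its values as atoms.
  obtain ⟨δ, hδ⟩ : ∃ δ : ℤ → SymmFn, ∀ k, δ k = if k = 1 then 1 else 0 := ⟨_, fun _ => rfl⟩
  have hδmul : ∀ k g, δ k * g = if k = 1 then g else 0 := by
    intro k g
    rw [hδ]
    split_ifs <;> simp
  have hK : ∀ f, f ∈ K ↔ ∀ m n, creation m (mode (-1) (n - 1) f) +
      mode (-1) n (creation (m - 1) f) - δ (m + n) * f = 0 := by
    intro f
    simp only [hδmul]
    simp only [K, Submodule.mem_iInf, LinearMap.mem_ker, LinearMap.sub_apply, LinearMap.add_apply,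
      LinearMap.comp_apply]
    refine forall_congr' fun m => forall_congr' fun n => ?_
    split_ifs <;> rfl
  have := forall_mem_of_expCoeff_mul_mem one_ne_zero K ?_ ?_ f
  · rw [← hδmul]
    exact sub_eq_zero.mp ((hK f).mp this m n)
  · rw [hK]
    intro m n
    have := mode_mode_neg_vacuum m n
    rw [creation_apply, creation_apply, map_sub, mode_one, mode_one, mode_one,
      show m - 1 - 2 = m - 3 by ring]
    rw [mul_one, hδ, ← this]
    ring
  · intro r f hf
    rw [hK] at hf
    have hcomm : ∀ m n g, creation m (expCoeff 1 n * g) =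
        (expCoeff 1 n + expCoeff 1 (n - 2)) * creation m g -
        expCoeff 1 (n - 1) * (creation (m - 1) g + creation (m + 1) g) := by
      intro m n g
      simp only [creation_apply]
      rw [mode_expCoeff_mul (by norm_num), mode_expCoeff_mul (by norm_num),
        show m - 2 - 1 = m - 1 - 2 by ring, show m - 2 + 1 = m + 1 - 2 by ring]
      ring
    have hcomm2 : ∀ m n g, mode (-1) m (expCoeff 1 n * g) = expCoeff 1 n * mode (-1) m g +
        mode (-1) (m - 1) (expCoeff 1 (n - 1) * g) + mode (-1) (m + 1) (expCoeff 1 (n - 1) * g) -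
        mode (-1) m (expCoeff 1 (n - 2) * g) := by
      intro m n g
      have := mode_expCoeff_neg_mul (s := -1) (by norm_num) m n g
      simp only [neg_neg] at this
      linear_combination this
    -- For negative r the factor vanishes, which starts the induction.
    have key : ∀ N : ℕ, ∀ r : ℤ, r < N → expCoeff 1 r * f ∈ K := by
      intro N
      induction N with
      | zero =>
        intro r hr
        rw [expCoeff_of_neg _ (by simpa using hr), zero_mul]
        exact K.zero_mem
      | succ N ih =>
        intro r hr
        have i1 := (hK _).mp (ih (r - 1) (by push_cast at hr; omega))
        have i2 := (hK _).mp (ih (r - 2) (by push_cast at hr; omega))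
        rw [hK]
        intro m n
        have a0 := hf m n
        have a1 := hf (m - 1) n
        have a2 := hf (m + 1) n
        have b1 := i1 m (n - 1)
        have b2 := i1 m (n + 1)
        have b3 := i2 m n
        have u1 := congrArg (creation m) (hcomm2 (n - 1) r f)
        have v1 := hcomm2 n r (creation (m - 1) f)
        have v2 := hcomm2 n (r - 2) (creation (m - 1) f)
        have v3 := hcomm2 n (r - 1) (creation (m - 1 - 1) f)
        have v4 := hcomm2 n (r - 1) (creation m f)
        rw [map_sub, map_add, map_add, hcomm] at u1
        simp only [hcomm (m - 1), map_sub, map_add, mul_add, add_mul, add_sub_cancel_right,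
          sub_add_cancel, show r - 1 - 1 = r - 2 by ring, show r - 1 - 2 = r - 3 by ring,
          show r - 2 - 1 = r - 3 by ring, show m - 1 + n = m + n - 1 by ring,
          show m + 1 + n = m + n + 1 by ring, show m + (n - 1) = m + n - 1 by ring,
          show m + (n + 1) = m + n + 1 by ring] at *
        linear_combination (expCoeff 1 r + expCoeff 1 (r - 2)) * a0 - expCoeff 1 (r - 1) * (a1 + a2)
          + b1 + b2 - b3 + u1 + v1 + v2 - v3 - v4
    exact key (r.natAbs + 1) r (by omega)

/-! ### Ordered products and the operators that add a box -/

section Word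

variable {S : Type*} [Ring S]

/-- The ordered product `A_{a₀} A_{a₁} ⋯ A_{a_{k-1}}`. -/
def word (A : ℤ → S) (a : ℕ → ℤ) (k : ℕ) : S := (List.ofFn fun i : Fin k => A (a i)).prod

theorem word_zero (A : ℤ → S) (a : ℕ → ℤ) : word A a 0 = 1 := by simp [word]

theorem word_succ (A : ℤ → S) (a : ℕ → ℤ) (k : ℕ) :
    word A a (k + 1) = A (a 0) * word A (fun i => a (i + 1)) k := by
  rw [word, List.ofFn_succ, List.prod_cons]
  rfl

theorem word_add (A : ℤ → S) (r k : ℕ) : ∀ a : ℕ → ℤ,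
    word A a (r + k) = word A a r * word A (fun i => a (i + r)) k := by
  induction r with
  | zero => intro a; simp [word_zero]
  | succ r ih =>
    intro a
    rw [show r + 1 + k = (r + k) + 1 by ring, word_succ, ih, word_succ, mul_assoc]
    rfl

variable {A B : ℤ → S}

/-- The bilinear A_{1-n} B_n passes one letter at a time; each passage lowers n by 1 and may raise
that letter by 1. A letter in row i, counted from 0, is raised when the new box at column a_i has
content a_i - i = -n. -/
theorem mul_word (hA : ∀ m n, A m * A n = -(A (n - 1) * A (m + 1)))
    (hAB : ∀ m n, A m * B (n - 1) + B n * A (m - 1) = if m + n = 1 then 1 else 0) (k : ℕ) :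
    ∀ (n : ℤ) (a : ℕ → ℤ), A (1 - n) * B n * word A a k =
      word A a k * (A (1 - (n - k)) * B (n - k)) +
        ∑ i ∈ Finset.range k, if a i + n = i then word A (Function.update a i (a i + 1)) k else 0 := by
  -- Passing one letter: the mixed relation gives the delta term, and the two signs, from the mixed
  -- relation and from exchanging the A's, cancel in the other.
  have hE : ∀ n m, A (1 - n) * B n * A m = A m * (A (1 - (n - 1)) * B (n - 1)) +
      if m + n = 0 then A (m + 1) else 0 := by
    intro n m
    have h1 : B n * A m = (if m + n = 0 then 1 else 0) - A (m + 1) * B (n - 1) := by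
      have := hAB (m + 1) n
      rw [add_sub_cancel_right] at this
      rw [eq_sub_iff_add_eq', this]
      exact if_congr (by omega) rfl rfl
    have h2 : A (1 - n) * A (m + 1) = -(A m * A (1 - (n - 1))) := by
      rw [hA]
      congr 3 <;> ring
    rw [mul_assoc, h1, mul_sub, ← mul_assoc, h2, neg_mul, sub_neg_eq_add, add_comm, mul_assoc]
    congr 1
    split_ifs with h
    · rw [mul_one]; congr 1; omega
    · rw [mul_zero]
  induction k with
  | zero => intro n a; simp [word_zero]
  | succ k ih =>
    intro n a
    rw [word_succ, ← mul_assoc, hE, add_mul, mul_assoc (A (a 0)), ih, mul_add,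
      Finset.sum_range_succ', add_assoc]
    congr 1
    · rw [← mul_assoc]
      push_cast
      rw [show n - 1 - (k : ℤ) = n - (k + 1) by ring]
    · congr 1
      · rw [Finset.mul_sum]
        refine Finset.sum_congr rfl fun i _ => ?_
        rw [mul_ite, mul_zero]
        refine if_congr (by push_cast; omega) ?_ rfl
        rw [word_succ, Function.update_of_ne (by simp)]
        congr 2
        funext j
        by_cases hj : j = i
        · subst hj; simp
        · rw [Function.update_of_ne hj, Function.update_of_ne (by omega)]
      · rw [ite_mul, zero_mul]
        refine if_congr (by simp) ?_ rfl
        rw [word_succ, Function.update_self]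
        congr 2

end Word

/-! ### Conjugation exchanges the two families -/

section Duality

variable {M : Type*} [AddCommGroup M] [Module ℚ M]

/-- The relations of charged fermions satisfied by two families of operators, together with a
vacuum vector `v`; the charge is hidden in the shifts of the indices. -/
structure IsFermionPair (A B : ℤ → Module.End ℚ M) (v : M) : Prop where
  left : ∀ m n, A m * A n = -(A (n - 1) * A (m + 1))
  right : ∀ m n, B m * B n = -(B (n - 1) * B (m + 1))
  mixed : ∀ m n, A m * B (n - 1) + B n * A (m - 1) = if m + n = 1 then 1 else 0
  left_vacuum : A 0 v = v
  right_vacuum : B 0 v = v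
  left_neg : ∀ m < 0, A m v = 0
  right_neg : ∀ m < 0, B m v = 0

namespace IsFermionPair

variable {A B : ℤ → Module.End ℚ M} {v : M}

theorem symm (H : IsFermionPair A B v) : IsFermionPair B A v where
  left := H.right
  right := H.left
  mixed m n := by rw [add_comm, H.mixed]; exact if_congr (by omega) rfl rfl
  left_vacuum := H.right_vacuum
  right_vacuum := H.left_vacuum
  left_neg := H.right_neg
  right_neg := H.left_neg

/-- The index sum in the mixed relation is 2 here, so the delta vanishes. Thus, up to sign, adding a
box of content -n to an A-word is adding one of content n to a B-word. -/
theorem mul_eq_neg (H : IsFermionPair A B v) (n : ℤ) :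
    A (1 - n) * B n = -(B (1 - -n) * A (-n)) := by
  have := H.mixed (1 - n) (n + 1)
  rw [if_neg (by omega), add_sub_cancel_right, show 1 - n - 1 = -n by ring] at this
  rw [show 1 - -n = n + 1 by ring]
  exact eq_neg_of_add_eq_zero_left this

theorem mul_vacuum (H : IsFermionPair A B v) {n : ℤ} (hn : n ≠ 0) : (A (1 - n) * B n) v = 0 := by
  rcases lt_or_gt_of_ne hn with h | h
  · rw [Module.End.mul_apply, H.right_neg n h, map_zero]
  · rw [H.mul_eq_neg, LinearMap.neg_apply, Module.End.mul_apply, H.left_neg _ (by omega), map_zero,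
      neg_zero]

theorem word_zero_vacuum (H : IsFermionPair A B v) {a : ℕ → ℤ} {k : ℕ} (ha : ∀ i < k, a i = 0) :
    word A a k v = v := by
  induction k generalizing a with
  | zero => simp [word_zero]
  | succ k ih =>
    rw [word_succ, Module.End.mul_apply, ih fun i hi => ha (i + 1) (by omega), ha 0 (by omega),
      H.left_vacuum]

/-- After passing all k letters the bilinear reaches the vacuum with index n - k ≠ 0 and kills it,
leaving the single admissible row. -/
theorem mul_word_vacuum (H : IsFermionPair A B v) {a : ℕ → ℤ} {k i : ℕ} (hi : i < k) {n : ℤ}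
    (hn : a i + n = i) (huniq : ∀ x < k, x ≠ i → a x + n ≠ x) (hk : n ≠ k) :
    (A (1 - n) * B n) (word A a k v) = word A (Function.update a i (a i + 1)) k v := by
  rw [← Module.End.mul_apply, mul_word H.left H.mixed, LinearMap.add_apply, Module.End.mul_apply,
    H.mul_vacuum (by omega), map_zero, zero_add, Finset.sum_eq_single i, if_pos hn]
  · intro x hx hxi
    rw [if_neg (huniq x (Finset.mem_range.mp hx) hxi)]
  · intro h
    exact absurd (Finset.mem_range.mpr hi) h

theorem antitone_of_conj {a b : ℕ → ℕ} (hab : ∀ i j, j < a i ↔ i < b j) : Antitone a := by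
  intro i i' hii
  by_contra h
  have h1 := (hab i' (a i)).mp (by omega)
  have h2 := (hab i (a i)).mpr (by omega)
  omega

/-- Induction on the number of boxes: remove a corner, then restore it on both sides with the same
bilinear. The sign in `mul_eq_neg` contributes one -1 per box. -/
theorem word_eq_word (H : IsFermionPair A B v) {k l : ℕ} : ∀ {a b : ℕ → ℕ},
    (∀ i j, j < a i ↔ i < b j) → b 0 ≤ k → a 0 ≤ l →
    word A (fun i => (a i : ℤ)) k v =
      (-1 : ℚ) ^ (∑ i ∈ Finset.range k, a i) • word B (fun j => (b j : ℤ)) l v := by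
  suffices h : ∀ N : ℕ, ∀ {a b : ℕ → ℕ}, (∑ i ∈ Finset.range k, a i) = N →
      (∀ i j, j < a i ↔ i < b j) → b 0 ≤ k → a 0 ≤ l →
      word A (fun i => (a i : ℤ)) k v = (-1 : ℚ) ^ N • word B (fun j => (b j : ℤ)) l v by
    intro a b hab hb ha
    exact h _ rfl hab hb ha
  intro N
  induction N with
  | zero =>
    intro a b hN hab hb ha
    have ha0 : ∀ i < k, a i = 0 := fun i hi =>
      Finset.sum_eq_zero_iff.mp hN i (Finset.mem_range.mpr hi)
    have hb0 : ∀ j, b j = 0 := by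
      intro j
      by_contra hj
      have h1 := (hab 0 j).mpr (by omega)
      have h2 := (hab 0 0).mp (by omega)
      have := ha0 0 (by omega)
      omega
    rw [H.word_zero_vacuum (fun i hi => by rw [ha0 i hi]; rfl),
      H.symm.word_zero_vacuum (fun i hi => by rw [hb0 i]; rfl)]
    simp
  | succ N ih =>
    intro a b hN hab hb ha
    have hb1 : 0 < b 0 := by
      by_contra h0
      have : ∀ i ∈ Finset.range k, a i = 0 := by
        intro i _
        by_contra hi
        have h1 := (hab i 0).mp (by omega)
        omega
      rw [Finset.sum_eq_zero this] at hN
      omega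
    -- The removed corner is the last box (i, j) of the last nonzero row; it is also the bottom box
    -- of its column.
    obtain ⟨i, hi⟩ : ∃ i, b 0 = i + 1 := ⟨b 0 - 1, by omega⟩
    obtain ⟨j, hj⟩ : ∃ j, a i = j + 1 := ⟨a i - 1, by have := (hab i 0).mpr (by omega); omega⟩
    have hantb : Antitone b := antitone_of_conj fun x y => (hab y x).symm
    have hanta : Antitone a := antitone_of_conj hab
    have hbj : b j = i + 1 := by
      have h1 := (hab i j).mp (by omega)
      have h2 := hantb (Nat.zero_le j)
      omega
    set a' := Function.update a i j with ha'
    set b' := Function.update b j i with hb'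
    have ha'i : a' i = j := Function.update_self ..
    have hb'j : b' j = i := Function.update_self ..
    have ha'ne : ∀ x, x ≠ i → a' x = a x := fun x hx => Function.update_of_ne hx ..
    have hb'ne : ∀ x, x ≠ j → b' x = b x := fun x hx => Function.update_of_ne hx ..
    have hab' : ∀ x y, y < a' x ↔ x < b' y := by
      intro x y
      have h0 := hab x y
      rcases eq_or_ne x i with hx | hx <;> rcases eq_or_ne y j with hy | hy
      · rw [hx, hy, ha'i, hb'j]; omega
      · rw [hx, ha'i, hb'ne y hy]; rw [hx] at h0; omega
      · rw [hy, ha'ne x hx, hb'j]; rw [hy] at h0; omega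
      · rw [ha'ne x hx, hb'ne y hy]; exact h0
    have hik : i < k := by omega
    have hjl : j < l := by have := hanta (Nat.zero_le i); omega
    have hsum : (∑ x ∈ Finset.range k, a' x) = N := by
      have h1 := Finset.add_sum_erase (Finset.range k) a (Finset.mem_range.mpr hik)
      have h2 := Finset.add_sum_erase (Finset.range k) a' (Finset.mem_range.mpr hik)
      rw [Finset.sum_congr rfl fun x hx => ha'ne x (Finset.ne_of_mem_erase hx)] at h2
      rw [hN] at h1
      have h3 : (∑ x ∈ (Finset.range k).erase i, a x) = ((Finset.range k).erase i).sum a := rfl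
      omega
    have hanta' : Antitone a' := antitone_of_conj hab'
    have hantb' : Antitone b' := antitone_of_conj fun x y => (hab' y x).symm
    have hb'0 : b' 0 ≤ k := by
      rcases eq_or_ne 0 j with h | h
      · rw [h, hb'j]; omega
      · rw [hb'ne 0 h]; exact hb
    have ha'0 : a' 0 ≤ l := by
      rcases eq_or_ne 0 i with h | h
      · rw [h, ha'i]; omega
      · rw [ha'ne 0 h]; exact ha
    -- The corner has content j - i, so n = i - j restores it.
    have key := congrArg (A (1 - ((i : ℤ) - j)) * B ((i : ℤ) - j)) (ih hsum hab' hb'0 ha'0)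
    rw [H.mul_word_vacuum (i := i) hik (by rw [ha'i]; ring) _ (by omega), map_smul, H.mul_eq_neg,
      LinearMap.neg_apply, H.symm.mul_word_vacuum (i := j) hjl (by rw [hb'j]; ring) _ (by omega)]
      at key
    · have e1 : Function.update (fun x => (a' x : ℤ)) i ((a' i : ℤ) + 1) = fun x => (a x : ℤ) := by
        funext x
        rcases eq_or_ne x i with hx | hx
        · rw [hx, Function.update_self, ha'i, hj]; push_cast; rfl
        · rw [Function.update_of_ne hx, ha'ne x hx]
      have e2 : Function.update (fun x => (b' x : ℤ)) j ((b' j : ℤ) + 1) = fun x => (b x : ℤ) := by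
        funext x
        rcases eq_or_ne x j with hx | hx
        · rw [hx, Function.update_self, hb'j, hbj]; push_cast; rfl
        · rw [Function.update_of_ne hx, hb'ne x hx]
      rw [e1, e2] at key
      rw [key, pow_succ, mul_neg_one, neg_smul, smul_neg]
    -- In either shape, row length minus row index is strictly decreasing, so no other row admits a
    -- box of the same content.
    · intro x _ hx
      rcases lt_or_gt_of_ne hx with h | h
      · have := hantb' h.le; omega
      · have := hantb' h.le; omega
    · intro x _ hx
      rcases lt_or_gt_of_ne hx with h | h
      · have := hanta' h.le; omega
      · have := hanta' h.le; omega

end IsFermionPair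

end Duality

/-! ### W and W* satisfy the fermion relations -/

theorem coeff_one_sub_single_mul {R : Type*} [CommRing R] (i : ℤ) (x : LaurentSeries R) (m : ℤ) :
    ((1 - HahnSeries.single i 1) * x).coeff m = x.coeff m - x.coeff (m - i) := by
  rw [sub_mul, one_mul, HahnSeries.coeff_sub, coeff_single_one_mul]

theorem W_neg (m : ℤ) : W (-m) = creation m := by
  ext1 f
  change ((1 - HahnSeries.single 2 1) * vertex 1 f).coeff (- -m) =
    (vertex 1 f).coeff m - (vertex 1 f).coeff (m - 2)
  rw [neg_neg]
  exact coeff_one_sub_single_mul 2 _ m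

theorem WStar_eq (m : ℤ) : WStar m = mode (-1) m := rfl

theorem isFermionPair : IsFermionPair (fun m => W (-m)) WStar 1 where
  left m n := by
    ext1 f
    simp only [W_neg, Module.End.mul_apply, LinearMap.neg_apply, creation_apply, map_sub]
    -- Each W_{-m} is a difference of two modes whose indices differ by 2; the relation holds for
    -- each of the four products.
    have h1 := mode_mode (s := 1) (by norm_num) m n f
    have h2 := mode_mode (s := 1) (by norm_num) m (n - 2) f
    have h3 := mode_mode (s := 1) (by norm_num) (m - 2) n f
    have h4 := mode_mode (s := 1) (by norm_num) (m - 2) (n - 2) f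
    rw [h1, h2, h3, h4, show m - 2 + 1 = m + 1 - 2 by ring, show n - 2 - 1 = n - 1 - 2 by ring]
    ring
  right m n := by
    ext1 f
    exact mode_mode (s := -1) (by norm_num) m n f
  mixed m n := by
    ext1 f
    simp only [W_neg, WStar_eq]
    refine (creation_mode_neg m n f).trans ?_
    split_ifs <;> rfl
  left_vacuum := by
    simp only [W_neg]
    rw [creation_apply, mode_one, mode_one, expCoeff_zero, expCoeff_of_neg _ (by norm_num), sub_zero]
  right_vacuum := by rw [WStar_eq, mode_one, expCoeff_zero]
  left_neg m hm := by
    simp only [W_neg]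
    rw [creation_apply, mode_one, mode_one, expCoeff_of_neg _ hm, expCoeff_of_neg _ (by omega),
      sub_zero]
  right_neg m hm := by rw [WStar_eq, mode_one, expCoeff_of_neg _ hm]

/-! ### Words applied to 1 as determinants -/

section Det

variable {R : Type*} [CommRing R]

/-- The Laurent series with `G₀` given, `G₁ = (z + z⁻¹) G₀` and
`G_{j+2} = (z + z⁻¹) G_{j+1} - κ_j G_j`. -/
def chebyshevSeries (κ : ℕ → ℕ) (G : LaurentSeries R) : ℕ → LaurentSeries R
  | 0 => G
  | 1 => zAddInv * G
  | j + 2 => zAddInv * chebyshevSeries κ G (j + 1) - κ j • chebyshevSeries κ G j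

theorem coeff_chebyshevSeries_one (κ : ℕ → ℕ) (G : LaurentSeries R) (a : ℤ) :
    (chebyshevSeries κ G 1).coeff a = G.coeff (a - 1) + G.coeff (a + 1) :=
  coeff_zAddInv_mul _ _

theorem coeff_chebyshevSeries_add_two (κ : ℕ → ℕ) (G : LaurentSeries R) (j : ℕ) (a : ℤ) :
    (chebyshevSeries κ G (j + 2)).coeff a = (chebyshevSeries κ G (j + 1)).coeff (a - 1) +
      (chebyshevSeries κ G (j + 1)).coeff (a + 1) - κ j • (chebyshevSeries κ G j).coeff a := by
  rw [chebyshevSeries, HahnSeries.coeff_sub, coeff_zAddInv_mul, HahnSeries.coeff_smul]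

/-- The unitriangular matrix of the three-term recurrence. -/
def recurrenceMatrix (κ : ℕ → ℕ) (z : R) (k : ℕ) : Matrix (Fin k) (Fin k) R :=
  Matrix.of fun p q => (if (p : ℕ) = q then 1 else 0) - (if (p : ℕ) + 1 = q then z else 0) +
    if (p : ℕ) + 2 = q then (κ p : R) else 0

theorem det_recurrenceMatrix (κ : ℕ → ℕ) (z : R) (k : ℕ) : (recurrenceMatrix κ z k).det = 1 := by
  rw [Matrix.det_of_isUpperTriangular]
  · exact Finset.prod_eq_one fun i _ => by simp [recurrenceMatrix]
  · intro i j hij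
    have : (j : ℕ) < i := hij
    simp only [recurrenceMatrix, Matrix.of_apply]
    rw [if_neg (by omega), if_neg (by omega), if_neg (by omega)]
    simp

theorem sum_mul_recurrence (κ : ℕ → ℕ) (z : R) (k : ℕ) (x : ℕ → R) (q : Fin k) :
    (∑ p : Fin k, x p * recurrenceMatrix κ z k p q) =
      match (q : ℕ) with
      | 0 => x 0
      | 1 => x 1 - x 0 * z
      | r + 2 => x (r + 2) - x (r + 1) * z + x r * κ r := by
  simp only [recurrenceMatrix, Matrix.of_apply]
  rw [Fin.sum_univ_eq_sum_range (fun p => x p * ((if p = (q : ℕ) then 1 else 0) -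
    (if p + 1 = (q : ℕ) then z else 0) + if p + 2 = (q : ℕ) then (κ p : R) else 0)) k]
  simp only [mul_add, mul_sub, Finset.sum_add_distrib, Finset.sum_sub_distrib, mul_ite, mul_one,
    mul_zero]
  have hq := q.2
  generalize (q : ℕ) = q at hq
  match q with
  | 0 => simp [hq]
  | 1 =>
    have h0 : 0 < k := by omega
    simp [hq, h0]
  | r + 2 =>
    have h1 : r + 1 < k := by omega
    have h2 : r < k := by omega
    simp [hq, h1, h2]

/-- Right multiplication by the unitriangular recurrence matrix keeps the determinant. It reduces
the top row to (x_0, 0, …, 0), because x obeys the recurrence, and turns the rows y into the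
three-term combinations s. -/
theorem mul_det_eq_det_cons {κ : ℕ → ℕ} {z : R} {k : ℕ} (x : ℕ → R) (y s : Fin k → ℕ → R)
    (hx1 : x 1 = x 0 * z) (hx : ∀ j, x (j + 2) = x (j + 1) * z - x j * κ j)
    (hs0 : ∀ i, s i 0 = y i 1 - y i 0 * z)
    (hs : ∀ i j, s i (j + 1) = y i (j + 2) - y i (j + 1) * z + y i j * κ j) :
    x 0 * (Matrix.of fun i j : Fin k => s i j).det =
      (Matrix.of fun i j : Fin (k + 1) =>
        (Fin.cons (α := fun _ => ℕ → R) x y : Fin (k + 1) → ℕ → R) i j).det := by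
  rw [← mul_one (Matrix.det (n := Fin (k + 1)) _), ← det_recurrenceMatrix κ z (k + 1),
    ← Matrix.det_mul, Matrix.det_succ_row_zero, Finset.sum_eq_single 0]
  · have h1 : ∀ i : Fin (k + 1), ∀ j : Fin (k + 1), ((Matrix.of fun i j : Fin (k + 1) =>
        (Fin.cons (α := fun _ => ℕ → R) x y : Fin (k + 1) → ℕ → R) i j) *
        recurrenceMatrix κ z (k + 1)) i j = _ := fun i j =>
      sum_mul_recurrence κ z (k + 1) ((Fin.cons (α := fun _ => ℕ → R) x y : _ → ℕ → R) i) j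
    rw [h1]
    simp only [Fin.val_zero, pow_zero, one_mul, Fin.cons_zero]
    congr 2
    ext i j
    rw [Matrix.submatrix_apply, Fin.succAbove_zero, h1, Matrix.of_apply, Fin.cons_succ, Fin.val_succ]
    generalize (j : ℕ) = j
    match j with
    | 0 => exact hs0 i
    | j + 1 => exact hs i j
  · intro j _ hj
    have h1 := sum_mul_recurrence κ z (k + 1) x j
    have h2 : ((Matrix.of fun i j : Fin (k + 1) =>
        (Fin.cons (α := fun _ => ℕ → R) x y : Fin (k + 1) → ℕ → R) i j) *
        recurrenceMatrix κ z (k + 1)) 0 j = 0 := by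
      refine h1.trans ?_
      obtain ⟨j, rfl⟩ := Fin.exists_succ_eq.mpr hj
      rw [Fin.val_succ]
      generalize (j : ℕ) = j
      match j with
      | 0 => simp [hx1]
      | j + 1 => simp only [hx]; ring
    rw [h2, mul_zero, zero_mul]
  · simp

theorem map_det_of {A : Type*} [CommRing A] (φ : A →+* R) {k : ℕ}
    (M : Fin k → Fin k → A) :
    φ (Matrix.of M).det = (Matrix.of fun i j => φ (M i j)).det := by
  rw [RingHom.map_det]; rfl

/-- Only the top row involves z, and the determinant is linear in that row. -/
theorem coeff_det_cons {k : ℕ} (x : ℕ → LaurentSeries R) (y : Fin k → ℕ → R) (m : ℤ) :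
    ((Matrix.of fun i j : Fin (k + 1) => (Fin.cons (α := fun _ => ℕ → LaurentSeries R) x
      (fun i j => HahnSeries.C (y i j)) : Fin (k + 1) → ℕ → LaurentSeries R) i j).det).coeff m =
    (Matrix.of fun i j : Fin (k + 1) => (Fin.cons (α := fun _ => ℕ → R)
      (fun j => (x j).coeff m) y : Fin (k + 1) → ℕ → R) i j).det := by
  rw [Matrix.det_succ_row_zero, Matrix.det_succ_row_zero, HahnSeries.coeff_sum]
  refine Finset.sum_congr rfl fun j _ => ?_
  have h1 : ∀ (n : ℕ) (u : LaurentSeries R) (d : R),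
      ((-1) ^ n * u * HahnSeries.C d).coeff m = (-1) ^ n * u.coeff m * d := by
    intro n u d
    have : (-1) ^ n * u * HahnSeries.C d = HahnSeries.C ((-1) ^ n * d) * u := by
      rw [map_mul, map_pow, map_neg, map_one]; ring
    rw [this, coeff_C_mul]; ring
  have h2 : ((Matrix.of fun i j : Fin (k + 1) => (Fin.cons (α := fun _ => ℕ → LaurentSeries R) x
      (fun i j => HahnSeries.C (y i j)) : Fin (k + 1) → ℕ → LaurentSeries R) i j).submatrix
        Fin.succ j.succAbove).det = HahnSeries.C (((Matrix.of fun i j : Fin (k + 1) =>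
        (Fin.cons (α := fun _ => ℕ → R) (fun j => (x j).coeff m) y :
          Fin (k + 1) → ℕ → R) i j).submatrix Fin.succ j.succAbove).det) := by
    refine Eq.trans ?_ (map_det_of (HahnSeries.C : R →+* LaurentSeries R) fun i i' : Fin k =>
      (Fin.cons (α := fun _ => ℕ → R) (fun j => (x j).coeff m) y : Fin (k + 1) → ℕ → R)
        i.succ (j.succAbove i')).symm
    congr 1
  rw [h2, h1]
  rfl

/-- The hypothesis on G is linear and invariant under shifting a, and the coefficients of every
Chebyshev series are integer combinations of shifted coefficients of G. -/
theorem map_coeff_chebyshevSeries {φ : R →+* LaurentSeries R} {G : LaurentSeries R} (κ : ℕ → ℕ)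
    (hG : ∀ a, φ (G.coeff a) = HahnSeries.C (G.coeff a) -
      zAddInv * HahnSeries.C (G.coeff (a - 1)) + HahnSeries.C (G.coeff (a - 2))) (j : ℕ) :
    ∀ a, φ ((chebyshevSeries κ G j).coeff a) =
      HahnSeries.C ((chebyshevSeries κ G j).coeff a) -
      zAddInv * HahnSeries.C ((chebyshevSeries κ G j).coeff (a - 1)) +
      HahnSeries.C ((chebyshevSeries κ G j).coeff (a - 2)) := by
  induction j using Nat.twoStepInduction with
  | zero => exact hG
  | one =>
    intro a
    simp only [coeff_chebyshevSeries_one, map_add, hG]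
    rw [show a - 1 - 2 = a - 2 - 1 by ring, show a + 1 - 1 = a - 1 + 1 by ring,
      show a + 1 - 2 = a - 2 + 1 by ring]
    ring
  | more j h1 h2 =>
    intro a
    simp only [coeff_chebyshevSeries_add_two, map_add, map_sub, map_nsmul, h1, h2]
    rw [show a - 1 - 2 = a - 2 - 1 by ring, show a + 1 - 1 = a - 1 + 1 by ring,
      show a + 1 - 2 = a - 2 + 1 by ring]
    simp only [nsmul_eq_mul]
    ring

/-- The substitution φ makes the rows three-term combinations centred at a_i - 1, which is why the
old rows reappear with index lowered by 1 below the new top row. -/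
theorem coeff_mul_map_det {φ : R →+* LaurentSeries R} {G : LaurentSeries R} (κ : ℕ → ℕ)
    (hG : ∀ a, φ (G.coeff a) = HahnSeries.C (G.coeff a) -
      zAddInv * HahnSeries.C (G.coeff (a - 1)) + HahnSeries.C (G.coeff (a - 2)))
    {k : ℕ} (a : Fin k → ℤ) (m : ℤ) :
    (G * φ (Matrix.of fun i j : Fin k =>
      (chebyshevSeries κ G j).coeff (a i)).det).coeff m =
    (Matrix.of fun i j : Fin (k + 1) => (Fin.cons (α := fun _ => ℕ → R)
      (fun j => (chebyshevSeries κ G j).coeff m)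
      (fun i j => (chebyshevSeries κ G j).coeff (a i - 1)) :
        Fin (k + 1) → ℕ → R) i j).det := by
  rw [← coeff_det_cons (chebyshevSeries κ G)]
  refine congrArg (fun x : LaurentSeries R => x.coeff m) ?_
  refine (congrArg (G * ·) (map_det_of (φ) fun i j : Fin k =>
    (chebyshevSeries κ G j).coeff (a i))).trans ?_
  refine (mul_det_eq_det_cons (κ := κ) (z := zAddInv) (chebyshevSeries κ G)
    (fun i j => HahnSeries.C ((chebyshevSeries κ G j).coeff (a i - 1)))
    (fun i j => φ ((chebyshevSeries κ G j).coeff (a i))) (mul_comm _ _)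
    (fun j => ?_) (fun i => ?_) (fun i j => ?_))
  · rw [chebyshevSeries, nsmul_eq_mul]; ring
  · rw [map_coeff_chebyshevSeries κ hG, coeff_chebyshevSeries_one, sub_add_cancel, map_add,
      show a i - 1 - 1 = a i - 2 by ring]
    simp only [chebyshevSeries]
    ring
  · rw [map_coeff_chebyshevSeries κ hG, coeff_chebyshevSeries_add_two, sub_add_cancel, map_sub,
      map_add, map_nsmul, nsmul_eq_mul, show a i - 1 - 1 = a i - 2 by ring]
    ring

end Det

/-- Each further operator borders the determinant; the lowering of the old indices by 1 is the term
-i of the determinant. -/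
theorem word_one_eq_det {t : ℚ} {G : LaurentSeries SymmFn} (κ : ℕ → ℕ)
    (hG : ∀ a, shiftHom t (G.coeff a) = HahnSeries.C (G.coeff a) -
      zAddInv * HahnSeries.C (G.coeff (a - 1)) + HahnSeries.C (G.coeff (a - 2)))
    {A : ℤ → Module.End ℚ SymmFn} (hA : ∀ m f, A m f = (G * shiftHom t f).coeff m) (k : ℕ) :
    ∀ a : ℕ → ℤ, word A a k 1 =
      (Matrix.of fun i j : Fin k => (chebyshevSeries κ G j).coeff (a i - i)).det := by
  induction k with
  | zero => intro a; simp [word_zero]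
  | succ k ih =>
    intro a
    rw [word_succ, Module.End.mul_apply, ih, hA,
      coeff_mul_map_det κ hG (fun i : Fin k => a (i + 1) - i)]
    congr 1
    ext i j
    refine Fin.cases ?_ (fun i => ?_) i
    · simp
    · simp [sub_sub]

/-- The series `∑ (h_n - h_{n-2}) zⁿ`. -/
def hSeries : LaurentSeries SymmFn :=
  (1 - HahnSeries.single 2 1) * HahnSeries.ofPowerSeries ℤ SymmFn (expMul 1)

theorem coeff_hSeries (a : ℤ) : hSeries.coeff a = expCoeff 1 a - expCoeff 1 (a - 2) :=
  coeff_one_sub_single_mul 2 _ a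

/-- With all κ equal to 1 the series are G times (z^{j+1} - z^{-j-1})/(z - z⁻¹), the Chebyshev
polynomials of the second kind in z + z⁻¹. -/
theorem coeff_chebyshevSeries_hSeries (j : ℕ) : ∀ a : ℤ,
    (chebyshevSeries (fun _ => 1) hSeries j).coeff a = h (a + j) - h (a - j - 2) := by
  induction j using Nat.twoStepInduction with
  | zero =>
    intro a
    rw [chebyshevSeries, coeff_hSeries, expCoeff_one, expCoeff_one, Nat.cast_zero, add_zero,
      sub_zero]
  | one =>
    intro a
    rw [coeff_chebyshevSeries_one, coeff_hSeries, coeff_hSeries]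
    simp only [expCoeff_one, Nat.cast_one]
    rw [show a + 1 - 2 = a - 1 by ring]
    ring
  | more j h1 h2 =>
    intro a
    rw [coeff_chebyshevSeries_add_two, h1, h2, h2, one_smul]
    push_cast
    rw [show a - 1 + (j + 1) = a + j by ring, show a + 1 - (j + 1) - 2 = a - j - 2 by ring,
      show a + 1 + ((j : ℤ) + 1) = a + (j + 2) by ring,
      show a - 1 - ((j : ℤ) + 1) - 2 = a - (j + 2) - 2 by ring]
    ring

theorem word_W_one (k : ℕ) (a : ℕ → ℤ) : word (fun m => W (-m)) a k 1 =
    (Matrix.of fun i j : Fin k => h (a i - i + j) - h (a i - i - j - 2)).det := by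
  rw [word_one_eq_det (t := -1) (G := hSeries) (fun _ => 1)]
  · simp only [coeff_chebyshevSeries_hSeries]
  · intro a
    simp only [coeff_hSeries, map_sub, shiftHom_expCoeff (s := 1) (t := -1) (by norm_num)]
    rw [show a - 2 - 1 = a - 1 - 2 by ring]
    ring
  · intro m f
    rw [W_neg, creation_apply, hSeries, mul_assoc]
    exact (coeff_one_sub_single_mul (R := SymmFn) 2 (vertex 1 f) m).symm

/-- With κ_0 = 2 and the other κ equal to 1 the multipliers are z^j + z^{-j} for j ≥ 1, but 1 rather
than 2 for j = 0. -/
theorem coeff_chebyshevSeries_expMul_neg (j : ℕ) : ∀ a : ℤ,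
    (chebyshevSeries (fun j => if j = 0 then 2 else 1)
      (HahnSeries.ofPowerSeries ℤ SymmFn (expMul (-1))) j).coeff a =
      if j = 0 then expCoeff (-1) a else expCoeff (-1) (a + j) + expCoeff (-1) (a - j) := by
  induction j using Nat.twoStepInduction with
  | zero => intro a; rfl
  | one =>
    intro a
    rw [coeff_chebyshevSeries_one, if_neg one_ne_zero, Nat.cast_one, add_comm]
    rfl
  | more j h1 h2 =>
    intro a
    have e1 : (j + 1 = 0) = False := by simp
    have e2 : (j + 2 = 0) = False := by simp
    rw [coeff_chebyshevSeries_add_two, h1, h2, h2]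
    simp only [e1, e2, if_false]
    push_cast
    rw [show a - 1 + (j + 1) = a + j by ring, show a + 1 - ((j : ℤ) + 1) = a - j by ring,
      show a + 1 + ((j : ℤ) + 1) = a + (j + 2) by ring,
      show a - 1 - ((j : ℤ) + 1) = a - (j + 2) by ring]
    rcases eq_or_ne j 0 with rfl | hj
    · simp only [Nat.cast_zero, add_zero, sub_zero, zero_add, if_true, two_nsmul]
      ring
    · simp only [if_neg hj, one_smul]
      ring

theorem word_WStar_one (k : ℕ) (hk : 0 < k) (a : ℕ → ℕ) : word WStar (fun i => (a i : ℤ)) k 1 =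
    ((-1 : ℚ) ^ (∑ i ∈ Finset.range k, a i) / 2) • (Matrix.of fun i j : Fin k =>
      e ((a i : ℤ) - i + j) + e ((a i : ℤ) - i - j)).det := by
  rw [word_one_eq_det (t := 1) (G := HahnSeries.ofPowerSeries ℤ SymmFn (expMul (-1)))
    (fun j => if j = 0 then 2 else 1)]
  · set D := Matrix.of fun i j : Fin k => e ((a i : ℤ) - i + j) + e ((a i : ℤ) - i - j) with hD
    let N : Matrix (Fin k) (Fin k) SymmFn := Matrix.of fun i j : Fin k =>
      (chebyshevSeries (fun j => if j = 0 then 2 else 1)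
        (HahnSeries.ofPowerSeries ℤ SymmFn (expMul (-1))) j).coeff ((a i : ℤ) - i)
    let u : Fin k → SymmFn := fun i => algebraMap ℚ SymmFn ((-1) ^ ((a i : ℤ) - i))
    -- The factor 2 makes up for the undoubled column j = 0, where the target entry is e + e.
    let w : Fin k → SymmFn := fun j => algebraMap ℚ SymmFn
      ((-1) ^ (j : ℕ) * if (j : ℕ) = 0 then 2 else 1)
    have he : ∀ n : ℤ, e n = algebraMap ℚ SymmFn ((-1) ^ n) * expCoeff (-1) n := by
      intro n
      rw [expCoeff_neg_one, Algebra.mul_smul_comm, ← Algebra.smul_def, smul_smul,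
        ← mul_zpow, neg_one_mul, neg_neg, one_zpow, one_smul]
    have hDN : D = Matrix.of fun i j => u i * (Matrix.of fun i j => w j * N i j) i j := by
      ext1 i j
      have hz : ∀ n : ℤ, ((-1 : ℚ)) ^ (n + (j : ℕ)) = (-1) ^ n * (-1) ^ (j : ℕ) := fun n => by
        rw [zpow_add₀ (by norm_num), zpow_natCast]
      have hz' : ∀ n : ℤ, ((-1 : ℚ)) ^ (n - (j : ℕ)) = (-1) ^ n * (-1) ^ (j : ℕ) := fun n => by
        rw [zpow_sub₀ (by norm_num), zpow_natCast, div_eq_mul_inv, ← inv_pow]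
        norm_num
      simp only [hD, Matrix.of_apply, u, w, N, coeff_chebyshevSeries_expMul_neg]
      rw [he, he, hz, hz']
      split_ifs with hj
      · rw [hj]
        simp only [Nat.cast_zero, add_zero, sub_zero, map_mul, map_ofNat]
        ring
      · simp only [map_mul, map_one]
        ring
    -- The signs (-1)^i of the rows and (-1)^j of the columns cancel; what is left is (-1)^{∑ a_i}
    -- and one factor 2, present because k > 0.
    have hprod : (∏ i, u i) * ∏ j, w j =
        algebraMap ℚ SymmFn (2 * (-1) ^ (∑ i ∈ Finset.range k, a i)) := by
      simp only [u, w]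
      rw [← map_prod, ← map_prod, ← map_mul, Finset.prod_mul_distrib, ← mul_assoc,
        ← Finset.prod_mul_distrib]
      congr 1
      have h1 : ∀ i : Fin k, ((-1 : ℚ) ^ ((a i : ℤ) - i)) * (-1) ^ (i : ℕ) = (-1) ^ a i := by
        intro i
        rw [zpow_sub₀ (by norm_num), zpow_natCast, zpow_natCast, div_mul_cancel₀]
        positivity
      rw [Finset.prod_congr rfl fun i _ => h1 i,
        Fin.prod_univ_eq_prod_range (fun i => (-1 : ℚ) ^ a i) k, Finset.prod_pow_eq_pow_sum,
        Fin.prod_univ_eq_prod_range (fun i => if i = 0 then (2 : ℚ) else 1) k,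
        Finset.prod_ite_eq', if_pos (Finset.mem_range.mpr hk), mul_comm]
    have hdet : D.det = algebraMap ℚ SymmFn (2 * (-1) ^ (∑ i ∈ Finset.range k, a i)) * N.det := by
      rw [hDN, Matrix.det_mul_column, Matrix.det_mul_row, ← mul_assoc, hprod]
    rw [hdet, ← Algebra.smul_def, smul_smul]
    have : ((-1 : ℚ) ^ (∑ i ∈ Finset.range k, a i) / 2) *
        (2 * (-1) ^ (∑ i ∈ Finset.range k, a i)) = 1 := by
      rw [div_mul_eq_mul_div, mul_left_comm, ← mul_pow]
      norm_num
    rw [this, one_smul]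
  · exact shiftHom_expCoeff (by norm_num)
  · intro m f
    rw [WStar_eq, mode_apply, vertex_apply, neg_neg]

/-! ### Young diagrams, trailing zeros and the Durfee square -/

theorem sum_eq_sum_of_conj {a b : ℕ → ℕ} (hab : ∀ i j, j < a i ↔ i < b j) {k l : ℕ}
    (hb : b 0 ≤ k) (ha : a 0 ≤ l) :
    (∑ i ∈ Finset.range k, a i) = ∑ j ∈ Finset.range l, b j := by
  have hanta := IsFermionPair.antitone_of_conj hab
  have hantb := IsFermionPair.antitone_of_conj fun x y => (hab y x).symm
  have h1 : ∀ i ∈ Finset.range k, a i = ∑ j ∈ Finset.range l, if j < a i then 1 else 0 := by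
    intro i _
    have := hanta (Nat.zero_le i)
    rw [← Finset.card_filter]
    have e : (Finset.range l).filter (fun j => j < a i) = Finset.range (a i) := by
      ext x; simp; omega
    rw [e, Finset.card_range]
  have h2 : ∀ j ∈ Finset.range l, b j = ∑ i ∈ Finset.range k, if i < b j then 1 else 0 := by
    intro j _
    have := hantb (Nat.zero_le j)
    rw [← Finset.card_filter]
    have e : (Finset.range k).filter (fun i => i < b j) = Finset.range (b j) := by
      ext x; simp; omega
    rw [e, Finset.card_range]
  rw [Finset.sum_congr rfl h1, Finset.sum_comm, Finset.sum_congr rfl h2]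
  exact Finset.sum_congr rfl fun j _ => Finset.sum_congr rfl fun i _ => if_congr (hab i j) rfl rfl

namespace IsFermionPair

variable {M : Type*} [AddCommGroup M] [Module ℚ M] {A B : ℤ → Module.End ℚ M} {v : M}

theorem word_vacuum_of_le (H : IsFermionPair A B v) {a : ℕ → ℤ} {k l : ℕ} (hkl : k ≤ l)
    (ha : ∀ i, k ≤ i → a i = 0) : word A a l v = word A a k v := by
  obtain ⟨m, rfl⟩ := Nat.exists_eq_add_of_le hkl
  rw [word_add, Module.End.mul_apply, H.word_zero_vacuum fun i _ => ha (i + k) (by omega)]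

/-- Splitting off the first `r` rows, where `r` is the size of the Durfee square. -/
theorem word_eq_word_mul_word (H : IsFermionPair A B v) {a b : ℕ → ℕ}
    (hab : ∀ i j, j < a i ↔ i < b j) {r k : ℕ} (har : a r ≤ r)
    (hk : b 0 ≤ r + k) : word A (fun i => (a i : ℤ)) (r + k) v =
      (-1 : ℚ) ^ (∑ j ∈ Finset.range r, (b j - r)) •
        (word A (fun i => (a i : ℤ)) r * word B (fun j => ((b j - r : ℕ) : ℤ)) r) v := by
  have hab' : ∀ i j, j < a (i + r) ↔ i < b j - r := by
    intro i j
    rw [hab]; omega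
  -- The rows below the first r form a partition with at most r columns, of lengths b_j - r; duality
  -- rewrites its word as one with exactly r letters.
  have h1 := H.word_eq_word (k := k) (l := r) (a := fun i => a (i + r)) (b := fun j => b j - r) hab'
    (by omega) (by simpa using har)
  rw [sum_eq_sum_of_conj hab' (k := k) (l := r) (by omega) (by simpa using har)] at h1
  rw [word_add, Module.End.mul_apply, h1, map_smul, Module.End.mul_apply]

end IsFermionPair

theorem conj_rowLen_colLen (μ : YoungDiagram) (i j : ℕ) : j < μ.rowLen i ↔ i < μ.colLen j := by
  rw [← YoungDiagram.mem_iff_lt_rowLen, ← YoungDiagram.mem_iff_lt_colLen]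

theorem card_eq_sum_rowLen (μ : YoungDiagram) {k : ℕ} (hk : μ.colLen 0 ≤ k) :
    μ.card = ∑ i ∈ Finset.range k, μ.rowLen i := by
  rw [YoungDiagram.card, Finset.card_eq_sum_card_fiberwise (f := Prod.fst) (t := Finset.range k)]
  · exact Finset.sum_congr rfl fun i _ => (YoungDiagram.rowLen_eq_card μ).symm
  · rintro ⟨i, j⟩ hc
    have h1 := YoungDiagram.mem_iff_lt_colLen.mp hc
    have h2 := μ.colLen_anti 0 j (Nat.zero_le j)
    simp only [Finset.coe_range, Set.mem_Iio]
    omega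

theorem word_W_rowLen (μ : YoungDiagram) (k : ℕ) :
    word (fun m => W (-m)) (fun i => (μ.rowLen i : ℤ)) k 1 = hDet μ k :=
  word_W_one k _

/-- Trailing zeros are harmless because W_0 fixes 1. -/
theorem word_W_rowLen_eq_orthoSchur (μ : YoungDiagram) {k : ℕ} (hk : μ.colLen 0 ≤ k) :
    word (fun m => W (-m)) (fun i => (μ.rowLen i : ℤ)) k 1 = orthoSchur μ := by
  rw [orthoSchur, ← word_W_rowLen]
  refine isFermionPair.word_vacuum_of_le hk fun i hi => ?_
  have := conj_rowLen_colLen μ i 0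
  rw [Nat.cast_eq_zero]
  omega

theorem word_WStar_rowLen (μ : YoungDiagram) {k : ℕ} (hk : μ.colLen 0 ≤ k) (hk0 : 0 < k) :
    word WStar (fun i => (μ.rowLen i : ℤ)) k 1 = ((-1 : ℚ) ^ μ.card / 2) • eDet μ k := by
  rw [card_eq_sum_rowLen μ hk]
  exact word_WStar_one k hk0 _

theorem orthoSchur_eq_word_WStar (μ : YoungDiagram) {l : ℕ} (hl : μ.rowLen 0 ≤ l) :
    orthoSchur μ = (-1 : ℚ) ^ (∑ j ∈ Finset.range l, μ.colLen j) •
      word WStar (fun j => (μ.colLen j : ℤ)) l 1 := by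
  rw [← word_W_rowLen_eq_orthoSchur μ le_rfl,
    isFermionPair.word_eq_word (conj_rowLen_colLen μ) le_rfl hl,
    sum_eq_sum_of_conj (conj_rowLen_colLen μ) le_rfl hl]

/-- Duality and the determinant for W* each contribute (-1)^{|λ|}, and the two signs cancel. -/
theorem orthoSchur_eq_eDet_transpose (μ : YoungDiagram) {l : ℕ} (hl : μ.rowLen 0 ≤ l)
    (hl0 : 0 < l) : orthoSchur μ = (1 / 2 : ℚ) • eDet μ.transpose l := by
  have hl' : μ.transpose.colLen 0 ≤ l := by rwa [YoungDiagram.colLen_transpose]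
  have h1 := word_WStar_rowLen μ.transpose hl' hl0
  rw [card_eq_sum_rowLen _ hl'] at h1
  simp only [YoungDiagram.rowLen_transpose] at h1
  rw [orthoSchur_eq_word_WStar μ hl, h1, smul_smul]
  congr 1
  rw [mul_div_assoc', ← mul_pow]
  norm_num

namespace IsFrobenius

variable {μ : YoungDiagram} {r : ℕ} {α β : Fin r → ℕ}

theorem rowLen_le (H : IsFrobenius μ r α β) : μ.rowLen r ≤ r := by
  have := (H.diag r).not.mpr (lt_irrefl r)
  rwa [YoungDiagram.mem_iff_lt_rowLen, not_lt] at this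

theorem colLen_le (H : IsFrobenius μ r α β) : μ.colLen r ≤ r := by
  have := (H.diag r).not.mpr (lt_irrefl r)
  rwa [YoungDiagram.mem_iff_lt_colLen, not_lt] at this

theorem le_colLen (H : IsFrobenius μ r α β) {j : ℕ} (hj : j < r) : r ≤ μ.colLen j := by
  have h1 := (H.diag (r - 1)).mpr (by omega)
  rw [YoungDiagram.mem_iff_lt_colLen] at h1
  have h2 := μ.colLen_anti j (r - 1) (by omega)
  omega

theorem le_rowLen (H : IsFrobenius μ r α β) {i : ℕ} (hi : i < r) : r ≤ μ.rowLen i := by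
  have h1 := (H.diag (r - 1)).mpr (by omega)
  rw [YoungDiagram.mem_iff_lt_rowLen] at h1
  have h2 := μ.rowLen_anti i (r - 1) (by omega)
  omega

/-- With i counted from 0, the i-th column reaches β_i - (r - 1 - i) boxes below the Durfee square.
-/
theorem sum_colLen_sub (H : IsFrobenius μ r α β) :
    (∑ j ∈ Finset.range r, (μ.colLen j - r)) + r * (r - 1) / 2 = ∑ i, β i := by
  rw [← Finset.sum_range_id, ← Finset.sum_range_reflect (fun i => i) r, ← Finset.sum_add_distrib,
    ← Fin.sum_univ_eq_sum_range]
  refine Finset.sum_congr rfl fun i _ => ?_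
  have h1 := H.leg i
  have h2 := H.le_colLen i.2
  have h3 := i.2
  omega

theorem sum_colLen (H : IsFrobenius μ r α β) :
    (∑ j ∈ Finset.range r, μ.colLen j) = (∑ i, β i) + r * (r + 1) / 2 := by
  have h0 := Finset.sum_range_id (r + 1)
  rw [Finset.sum_range_succ', add_zero, add_tsub_cancel_right, mul_comm] at h0
  rw [← h0, ← Fin.sum_univ_eq_sum_range, ← Fin.sum_univ_eq_sum_range, ← Finset.sum_add_distrib]
  refine Finset.sum_congr rfl fun i _ => ?_
  have h1 := H.leg i
  omega

/-- The rows below the Durfee square are dualized. The sign so obtained has exponent |β| - r(r-1)/2,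
of the same parity as |β| + r(r-1)/2. -/
theorem orthoSchur_eq (H : IsFrobenius μ r α β) :
    orthoSchur μ = (-1 : ℚ) ^ ((∑ i, β i) + r * (r - 1) / 2) •
      ((List.ofFn fun i : Fin r => W (-(α i : ℤ) - (i + 1))).prod *
        (List.ofFn fun i : Fin r => WStar ((β i : ℤ) - (r - (i + 1)))).prod) 1 := by
  rw [← word_W_rowLen_eq_orthoSchur μ (k := r + μ.colLen 0) (by omega),
    isFermionPair.word_eq_word_mul_word (conj_rowLen_colLen μ) H.rowLen_le (by omega), ← H.sum_colLen_sub,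
    add_assoc, pow_add,
    ← two_mul (r * (r - 1) / 2), pow_mul (-1 : ℚ) 2, neg_one_sq, one_pow, mul_one]
  congr 3
  · refine congrArg (fun f => (List.ofFn f).prod) (funext fun i => ?_)
    have := H.arm i
    exact congrArg W (by beta_reduce; omega)
  · refine congrArg (fun f => (List.ofFn f).prod) (funext fun i => ?_)
    have h1 := H.leg i
    have h2 := H.le_colLen i.2
    exact congrArg WStar (by beta_reduce; omega)

/-- The W*-word of the conjugate partition is split, with the two families exchanged. Boxes in the
columns beyond the first r are counted once by the sign of the full duality and once by that of the
tail, so only the first r columns, |β| + r(r+1)/2 boxes in all, determine the sign. -/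
theorem orthoSchur_eq' (H : IsFrobenius μ r α β) :
    orthoSchur μ = (-1 : ℚ) ^ ((∑ i, β i) + r * (r + 1) / 2) •
      ((List.ofFn fun i : Fin r => WStar ((β i : ℤ) + (i + 1))).prod *
        (List.ofFn fun i : Fin r => W (-(α i : ℤ) + (r - (i + 1)))).prod) 1 := by
  have hconj : ∀ i j, j < μ.colLen i ↔ i < μ.rowLen j := fun i j => (conj_rowLen_colLen μ j i).symm
  have hsum : (∑ j ∈ Finset.range (μ.rowLen 0), μ.colLen (r + j)) =
      ∑ i ∈ Finset.range r, (μ.rowLen i - r) := by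
    refine sum_eq_sum_of_conj (fun i j => ?_) (by omega) ?_
    · rw [hconj]; omega
    · simpa using H.colLen_le
  rw [orthoSchur_eq_word_WStar μ (l := r + μ.rowLen 0) (by omega),
    isFermionPair.symm.word_eq_word_mul_word hconj H.colLen_le (by omega), Finset.sum_range_add, hsum,
    H.sum_colLen, smul_smul,
    pow_add _ _ (∑ i ∈ Finset.range r, (μ.rowLen i - r)), mul_assoc, ← mul_pow, neg_one_mul,
    neg_neg, one_pow, mul_one]
  congr 3
  · refine congrArg (fun f => (List.ofFn f).prod) (funext fun i => ?_)
    have := H.leg i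
    exact congrArg WStar (by beta_reduce; omega)
  · refine congrArg (fun f => (List.ofFn f).prod) (funext fun i => ?_)
    have h1 := H.arm i
    have h2 := H.le_rowLen i.2
    exact congrArg W (by beta_reduce; omega)

end IsFrobenius

end SymFun

end
theorem theoremT (μ : YoungDiagram) :
    -- `W_{-λ_1} ⋯ W_{-λ_k}.1 = o_λ = det (h_{λ_i-i+j} - h_{λ_i-i-j})`
    (∀ k : ℕ, μ.colLen 0 ≤ k →
      (List.ofFn fun i : Fin k => SymFun.W (-(μ.rowLen i : ℤ))).prod 1 = SymFun.orthoSchur μ ∧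
      SymFun.orthoSchur μ = SymFun.hDet μ k) ∧
    -- `W*_{λ_1} ⋯ W*_{λ_k}.1 = (-1)^{|λ|} / 2 · det (e_{λ_i-i+j} + e_{λ_i-i-j+2})`
    (∀ k : ℕ, μ.colLen 0 ≤ k → 0 < k →
      (List.ofFn fun i : Fin k => SymFun.WStar (μ.rowLen i : ℤ)).prod 1 =
        ((-1 : ℚ) ^ μ.card / 2) • SymFun.eDet μ k) ∧
    -- `o_λ = 1/2 · det (e_{λ'_i-i+j} + e_{λ'_i-i-j+2})`
    (∀ l : ℕ, μ.rowLen 0 ≤ l → 0 < l →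
      SymFun.orthoSchur μ = (1 / 2 : ℚ) • SymFun.eDet μ.transpose l) ∧
    -- the two realizations in Frobenius notation
    (∀ (r : ℕ) (α β : Fin r → ℕ), SymFun.IsFrobenius μ r α β →
      SymFun.orthoSchur μ = (-1 : ℚ) ^ ((∑ i, β i) + r * (r - 1) / 2) •
        ((List.ofFn fun i : Fin r => SymFun.W (-(α i : ℤ) - (i + 1))).prod *
          (List.ofFn fun i : Fin r => SymFun.WStar ((β i : ℤ) - (r - (i + 1)))).prod) 1 ∧
      SymFun.orthoSchur μ = (-1 : ℚ) ^ ((∑ i, β i) + r * (r + 1) / 2) •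
        ((List.ofFn fun i : Fin r => SymFun.WStar ((β i : ℤ) + (i + 1))).prod *
          (List.ofFn fun i : Fin r => SymFun.W (-(α i : ℤ) + (r - (i + 1)))).prod) 1) := by
  refine ⟨fun k hk => ⟨SymFun.word_W_rowLen_eq_orthoSchur μ hk, ?_⟩,
    fun k hk hk0 => SymFun.word_WStar_rowLen μ hk hk0,
    fun l hl hl0 => SymFun.orthoSchur_eq_eDet_transpose μ hl hl0,
    fun r α β H => ⟨H.orthoSchur_eq, H.orthoSchur_eq'⟩⟩
  rw [← SymFun.word_W_rowLen_eq_orthoSchur μ hk, SymFun.word_W_rowLen]
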